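/- **Setting.** Let $f:\mathbb{R}^{m_1}\times\cdots\times\mathbb{R}^{m_n}\to\mathbb{R}$ be differentiable and, for $i=1,\dots,n$, let $h_i=(h_{i,1},\dots,h_{i,p_i}):\mathbb{R}^{m_i}\to\mathbb{R}^{p_i}$ have convex differentiable components. Put $S_i:=\{w\in\mathbb{R}^{m_i}: h_i(w)\le 0\}\neq\emptyset$ and $F(z):=f(z)+\sum_{i=1}^n\delta_{S_i}(x_i)$ for $z=(x_1,\dots,x_n)$, where $\delta_{S}$ is $0$ on $S$ and $+\infty$ elsewhere. Let $\bar\varepsilon>0$ and $\bar S_i:=\{w:\operatorname{dist}(w,S_i)\le\bar\varepsilon\}$. Norms are Euclidean unless marked otherwise, and $\nabla_i f$ is the $i$-th block of $\nabla f$. For $G:\mathbb{E}\to(-\infty,+\infty]$ on a Euclidean space, the Fréchet subdifferential is $$\partial G(x):=\Big\{u:\ \liminf_{y\ne x,\,y\to x}\frac{G(y)-G(x)-\langle u,y-x\rangle}{\|y-x\|}\ge 0\Big\}\ \text{ if } G(x)<\infty,\qquad \partial G(x):=\emptyset\ \text{ otherwise;}$$ $x$ is a *stationary point* of $G$ if $0\in\partial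 G(x)$. $G$ has the *Łojasiewicz property* at a stationary point $\bar x$ if there are $c>0$, $\theta\in[0,1)$, $\eta>0$ such that $|G(x)-G(\bar x)|^\theta\le c\,\operatorname{dist}(0,\partial G(x))$ for all $x\in B_\eta(\bar x)$, with the conventions $0^0=0$ and $\operatorname{dist}(0,\emptyset)=+\infty$. **Assumptions.** 1. *(Blockwise Lipschitz gradients.)* For each $i$ there is $L_i>0$ with $\|\nabla_i f(z_1)-\nabla_i f(z_2)\|\le L_i\|z_1-z_2\|$ for all $z_1,z_2\in\bar S_1\times\cdots\times\bar S_n$. Put $L:=\max_i L_i$, fix $\gamma>1$, and set $M_l:=\gamma L$; let $M_u\ge M_l$. 2. *(Constraints.)* For each $i$, the set $S_i$ is convex and compact; $h_i$ is linear (affine) or satisfies Slater's condition, i.e. $h_i(\hat x_i)<0$ componentwise for some $\hat x_i$; and there is $\tilde c_i\ge 0$ such that $$\operatorname{dist}(w,S_i)\le\tilde c_i\,\|\max\{h_i(w),0\}\|\quad\text{for all } w \text{ with } \operatorname{dist}(w,\bar S_i)\le \frac{1}{M_l}\sup_{z\in\bar S_1\times\cdots\times\bar S_n}\|\nabla_i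 f(z)\|.$$ 3. *(Łojasiewicz.)* $F$ has the Łojasiewicz property at each of its stationary points. 4. *(Tolerances.)* $\varepsilon^{(k)}\ge 0$, $\sum_k\varepsilon^{(k)}<\infty$, and there is $\bar\theta\in(0,1)$ with $\sum_k (e^{(k)})^{\bar\theta}<\infty$, where $e^{(k)}:=\sum_{t\ge k}(\varepsilon^{(t)})^2$. **Algorithm.** Define the residual function $$\begin{aligned} r_i(x,\lambda,\tilde x):={}&\max\{\langle x,\,x-\tilde x+\nabla h_i(x)\lambda\rangle,0\}+\|x-\tilde x+\nabla h_i(x)\lambda\|_\infty\\&+\|\max\{h_i(x),0\}\|_\infty+\max\{-\langle\lambda,h_i(x)\rangle,0\},\end{aligned}$$ where $\nabla h_i(x)\lambda=\sum_j\lambda_j\nabla h_{i,j}(x)$. A sequence $z^{(k)}=(x_1^{(k)},\dots,x_n^{(k)})$, $k\ge 0$, with arbitrary $z^{(0)}$, is generated by the infeasible inexact PALM (proximal alternating linearized minimization) with tolerances $0\le\varepsilon^{(k)}\le\bar\varepsilon$ and proximal parameters $\sigma_i^{(k)}\in[M_l,M_u]$ if for all $k\ge 0$ and $i=1,\dots,n$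 there is $\lambda\in\mathbb{R}^{p_i}_{+}$ with $$\sqrt{r_i\big(x_i^{(k+1)},\lambda,\tilde x_i^{(k)}\big)}\le\varepsilon^{(k)},\qquad \tilde x_i^{(k)}:=x_i^{(k)}-\frac{1}{\sigma_i^{(k)}}\nabla_i f\big(x_1^{(k+1)},\dots,x_{i-1}^{(k+1)},x_i^{(k)},\dots,x_n^{(k)}\big).$$ **Theorem.** Under assumptions 1–4, every sequence $\{z^{(k)}\}$ generated by the infeasible inexact PALM converges to a stationary point of $F$. -/

import Mathlib

open Filter Topology
open scoped ENNReal

/-! ## Fréchet subdifferential and the Łojasiewicz property -/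

/-- The Fréchet subdifferential of an extended-valued function `G`. It is empty outside
`dom G = {x | G x < ∞}`; at `x ∈ dom G` it consists of all `u` such that
`liminf_{y ≠ x, y → x} (G y - G x - ⟨u, y - x⟩) / ‖y - x‖ ≥ 0`. -/
def frechetSubdiff {E : Type*} [NormedAddCommGroup E] [InnerProductSpace ℝ E]
    (G : E → EReal) (x : E) : Set E :=
  {u | G x ≠ ⊤ ∧
    0 ≤ liminf (fun y => (G y - G x - ((inner ℝ u (y - x) : ℝ) : EReal)) / ((‖y - x‖ : ℝ) : EReal))
      (𝓝[≠] x)}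

/-- `x` is a stationary point of `G` if `0 ∈ ∂G(x)`. -/
def IsStationaryPt {E : Type*} [NormedAddCommGroup E] [InnerProductSpace ℝ E]
    (G : E → EReal) (x : E) : Prop :=
  0 ∈ frechetSubdiff G x

/-- The power `a ^ θ` with the convention `0 ^ 0 = 0`. -/
noncomputable def powZero (a : ℝ≥0∞) (θ : ℝ) : ℝ≥0∞ := by
  classical exact if a = 0 then 0 else a ^ θ

/-- The Łojasiewicz property of `G` at the (stationary) point `xbar`:
`|G x - G xbar| ^ θ ≤ c * dist (0, ∂G x)` on a ball around `xbar`, with `0 ^ 0 = 0`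
and `dist (0, ∅) = ∞`. -/
def LojasiewiczAt {E : Type*} [NormedAddCommGroup E] [InnerProductSpace ℝ E]
    (G : E → EReal) (xbar : E) : Prop :=
  ∃ c : ℝ, 0 < c ∧ ∃ θ : ℝ, 0 ≤ θ ∧ θ < 1 ∧ ∃ η : ℝ, 0 < η ∧
    ∀ x ∈ Metric.ball xbar η,
      powZero (G x - G xbar).abs θ ≤ ENNReal.ofReal c * Metric.infEDist 0 (frechetSubdiff G x)

/-! ## The block-structured problem -/

/-- The `i`-th variable block lives in the Euclidean space `ℝ^{m i}`. -/
abbrev Blk {n : ℕ} (m : Fin n → ℕ) (i : Fin n) : Type := EuclideanSpace ℝ (Fin (m i))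

/-- The product `⊗ᵢ ℝ^{m i}` with its Euclidean norm. -/
abbrev BlockSpace {n : ℕ} (m : Fin n → ℕ) : Type := PiLp 2 (fun i => Blk m i)

/-- The feasible set `{w | g j w ≤ 0 for all j}` of one block. -/
def feasSet {E : Type*} {q : ℕ} (g : Fin q → E → ℝ) : Set E :=
  {w | ∀ j, g j w ≤ 0}

/-- The indicator function of a set: `0` on the set, `∞` off it. -/
noncomputable def setIndicator {E : Type*} (S : Set E) (w : E) : EReal := by
  classical exact if w ∈ S then 0 else ⊤

/-- The extended-valued objective `F(z) = f(z) + ∑ᵢ δ_{Sᵢ}(zᵢ)`. -/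
noncomputable def extObjective {n : ℕ} {m p : Fin n → ℕ} (f : BlockSpace m → ℝ)
    (h : ∀ i, Fin (p i) → Blk m i → ℝ) (z : BlockSpace m) : EReal :=
  (f z : EReal) + ∑ i, setIndicator (feasSet (h i)) (z i)

/-- The partial gradient `∇ᵢ f(z)`, the `i`-th block of the gradient. -/
noncomputable def blockGrad {n : ℕ} {m : Fin n → ℕ} (f : BlockSpace m → ℝ) (i : Fin n)
    (z : BlockSpace m) : Blk m i :=
  gradient f z i

/-- All points whose distance to the (nonempty) set `S` is at most `r`. -/
def enlarge {E : Type*} [PseudoMetricSpace E] (r : ℝ) (S : Set E) : Set E :=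
  {w | Metric.infDist w S ≤ r}

/-- The product `⊗ᵢ S̄ᵢ`, where `S̄ᵢ` collects the points at distance at most `εbar` from `Sᵢ`. -/
def enlargedFeas {n : ℕ} {m p : Fin n → ℕ} (h : ∀ i, Fin (p i) → Blk m i → ℝ) (εbar : ℝ) :
    Set (BlockSpace m) :=
  {z | ∀ i, z i ∈ enlarge εbar (feasSet (h i))}

/-- `sup {‖∇ᵢ f(z)‖ : z ∈ ⊗ᵢ S̄ᵢ}`. -/
noncomputable def gradBound {n : ℕ} {m p : Fin n → ℕ} (f : BlockSpace m → ℝ)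
    (h : ∀ i, Fin (p i) → Blk m i → ℝ) (εbar : ℝ) (i : Fin n) : ℝ :=
  sSup ((fun z => ‖blockGrad f i z‖) '' enlargedFeas h εbar)

/-- Blockwise Lipschitz gradients over `⊗ᵢ S̄ᵢ`, with moduli `L i > 0`. -/
def BlockLipschitzGrad {n : ℕ} {m p : Fin n → ℕ} (f : BlockSpace m → ℝ)
    (h : ∀ i, Fin (p i) → Blk m i → ℝ) (εbar : ℝ) (L : Fin n → ℝ) : Prop :=
  ∀ i, 0 < L i ∧ ∀ z₁ ∈ enlargedFeas h εbar, ∀ z₂ ∈ enlargedFeas h εbar,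
    ‖blockGrad f i z₁ - blockGrad f i z₂‖ ≤ L i * ‖z₁ - z₂‖

/-- The constraint mapping with components `g j` is linear (that is, affine, as in `A w ≤ b`). -/
def IsLinearConstraint {E : Type*} [AddCommGroup E] [Module ℝ E] {q : ℕ}
    (g : Fin q → E → ℝ) : Prop :=
  ∀ j, ∃ A : E →ᵃ[ℝ] ℝ, ∀ w, g j w = A w

/-- The Slater constraint qualification. -/
def SlaterCQ {E : Type*} {q : ℕ} (g : Fin q → E → ℝ) : Prop :=
  ∃ w, ∀ j, g j w < 0

/-- The vector `max {g(w), 0}` (componentwise) in Euclidean space. -/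
noncomputable def posPartVec {E : Type*} {q : ℕ} (g : Fin q → E → ℝ) (w : E) :
    EuclideanSpace ℝ (Fin q) :=
  WithLp.toLp 2 (fun j => max (g j w) 0)

/-- The Hoffman-like error bound `dist(w, S) ≤ c ‖max {g(w), 0}‖` for all `w` in `T`, where `S` is
the set described by `g`. -/
def HoffmanBoundOn {E : Type*} [PseudoMetricSpace E] {q : ℕ} (g : Fin q → E → ℝ) (T : Set E) :
    Prop :=
  ∃ c : ℝ, 0 ≤ c ∧ ∀ w ∈ T, Metric.infDist w (feasSet g) ≤ c * ‖posPartVec g w‖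

/-- The assumption on the constraints. `Ml` is the lower bound on the proximal parameters. The
Hoffman-like bound is required on the set of points at distance at most `gradBound / Ml` from
`S̄ᵢ`. -/
structure ConstraintAssumption {n : ℕ} {m p : Fin n → ℕ} (f : BlockSpace m → ℝ)
    (h : ∀ i, Fin (p i) → Blk m i → ℝ) (εbar Ml : ℝ) : Prop where
  nonempty : ∀ i, (feasSet (h i)).Nonempty
  convex : ∀ i, Convex ℝ (feasSet (h i))
  compact : ∀ i, IsCompact (feasSet (h i))
  linear_or_slater : ∀ i, IsLinearConstraint (h i) ∨ SlaterCQ (h i)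
  hoffman : ∀ i, HoffmanBoundOn (h i)
    (enlarge (gradBound f h εbar i / Ml) (enlarge εbar (feasSet (h i))))

/-! ## The algorithm -/

/-- `e^{(k)} = ∑_{t ≥ k} (ε^{(t)})²`. -/
noncomputable def sqTail (ε : ℕ → ℝ) (k : ℕ) : ℝ := ∑' t, ε (k + t) ^ 2

/-- The condition on the tolerances: nonnegative and summable, and `(e^{(k)})^θ̄` is summable for
some `θ̄ ∈ (0, 1)`. -/
def ToleranceCondition (ε : ℕ → ℝ) : Prop :=
  (∀ k, 0 ≤ ε k) ∧ Summable ε ∧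
    ∃ θ : ℝ, 0 < θ ∧ θ < 1 ∧ Summable (fun k => sqTail ε k ^ θ)

/-- The vector `x - x̃ + ∇g(x) lam`, where `∇g(x) lam = ∑ⱼ lamⱼ ∇gⱼ(x)`. -/
noncomputable def kktVec {d q : ℕ} (g : Fin q → EuclideanSpace ℝ (Fin d) → ℝ)
    (x : EuclideanSpace ℝ (Fin d)) (lam : Fin q → ℝ) (xt : EuclideanSpace ℝ (Fin d)) :
    EuclideanSpace ℝ (Fin d) :=
  x - xt + ∑ j, lam j • gradient (g j) x

/-- The residual function `r(x, lam, x̃)` of the projection of `x̃` onto `{g ≤ 0}`. The norm on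
`Fin d → ℝ` and on `Fin q → ℝ` is the maximum norm. -/
noncomputable def kktResidual {d q : ℕ} (g : Fin q → EuclideanSpace ℝ (Fin d) → ℝ)
    (x : EuclideanSpace ℝ (Fin d)) (lam : Fin q → ℝ) (xt : EuclideanSpace ℝ (Fin d)) : ℝ :=
  max (inner ℝ x (kktVec g x lam xt)) 0
    + ‖(WithLp.ofLp (kktVec g x lam xt) : Fin d → ℝ)‖
    + ‖(fun j => max (g j x) 0 : Fin q → ℝ)‖
    + max (-∑ j, lam j * g j x) 0

/-- `(u_{<i}, v_{≥i})`: the blocks before `i` from `u`, the others from `v`. -/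
noncomputable def mixBlocks {n : ℕ} {m : Fin n → ℕ} (i : Fin n) (u v : BlockSpace m) :
    BlockSpace m :=
  WithLp.toLp 2 (fun j => if j < i then u j else v j)

/-- The gradient step `x̃ᵢ^{(k)} = xᵢ^{(k)} - (1/σᵢ^{(k)}) ∇ᵢ f(x_{<i}^{(k+1)}, x_{≥i}^{(k)})`. -/
noncomputable def gradStep {n : ℕ} {m : Fin n → ℕ} (f : BlockSpace m → ℝ)
    (σ : ℕ → Fin n → ℝ) (z : ℕ → BlockSpace m) (k : ℕ) (i : Fin n) : Blk m i :=
  z k i - (1 / σ k i) • blockGrad f i (mixBlocks i (z (k + 1)) (z k))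

/-- `z` is an iterate sequence generated by the infeasible inexact proximal alternating linearized
minimization method with tolerances `ε^{(k)} ∈ [0, εbar]` and proximal parameters
`σᵢ^{(k)} ∈ [Ml, Mu]`. -/
structure IsInexactPALM {n : ℕ} {m p : Fin n → ℕ} (f : BlockSpace m → ℝ)
    (h : ∀ i, Fin (p i) → Blk m i → ℝ) (εbar Ml Mu : ℝ) (ε : ℕ → ℝ) (σ : ℕ → Fin n → ℝ)
    (z : ℕ → BlockSpace m) : Prop where
  tol_nonneg : ∀ k, 0 ≤ ε k
  tol_le : ∀ k, ε k ≤ εbar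
  Ml_le_Mu : Ml ≤ Mu
  prox_mem : ∀ k i, σ k i ∈ Set.Icc Ml Mu
  inexact : ∀ k i, ∃ lam : Fin (p i) → ℝ, (∀ j, 0 ≤ lam j) ∧
    Real.sqrt (kktResidual (h i) (z (k + 1) i) lam (gradStep f σ z k i)) ≤ ε k

/-! A residual of at most `ε²` yields two facts about a block update: it lies within `O(ε²)` of its
feasible set, and it satisfies the variational inequality of the projection of `x̃` up to `O(ε²)`
(`exists_bound_of_kktResidual_le`). Testing that inequality near the old iterate gives, because `σ ≥
γ L`, a decrease of `f` by `(γ - 1) L ‖step‖²` up to the squares of two consecutive tolerances.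
Adding a multiple of the tails of `∑ ε²` to `f` turns this into a true descent.

The iterates may be infeasible, so the Łojasiewicz inequality is applied at the exact projections
`P`: these are feasible, `O(ε)`-close to the new iterate, and carry a subgradient of size `O(‖step‖
+ ε)`. The delicate point is that `f` at `P` and at the iterate differs only by `O(‖step‖² + ε²)`,
since the two variational inequalities control the first-order term (`inexact_projection_step`,
`exists_palm_step_bound`). With a Łojasiewicz exponent of at least `1/2`, these squares become
`O(‖step‖ + ε)`. Compactness makes the inequality uniform along the tail of the sequence, and a
telescoping argument (`summable_of_lojasiewicz_descent`) gives finite length, hence convergence. -/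

/-- Lengths `D k` controlled by the decrease of a Lyapunov sequence `φ` are summable as soon as `φ`
satisfies a perturbed Łojasiewicz inequality. -/
theorem summable_of_lojasiewicz_descent {φ D s : ℕ → ℝ} {a C θ : ℝ} (ha : 0 < a) (hC : 0 ≤ C)
    (hθ0 : 0 < θ) (hθ1 : θ < 1) (hφ : ∀ k, 0 ≤ φ k) (hD : ∀ k, 0 ≤ D k) (hs : ∀ k, 0 ≤ s k)
    (hsum : Summable s) (hdesc : ∀ k, φ (k + 1) + a * D k ^ 2 ≤ φ k)
    (hKL : ∀ k, φ (k + 1) ^ θ ≤ C * (D k + s k)) : Summable D := by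
  have hθ' : 0 < 1 - θ := by linarith
  set ψ : ℕ → ℝ := fun k => φ k ^ (1 - θ) with hψ
  have hψ0 : ∀ k, 0 ≤ ψ k := fun k => Real.rpow_nonneg (hφ k) _
  have hψanti : ∀ k, ψ (k + 1) ≤ ψ k := fun k =>
    Real.rpow_le_rpow (hφ _) (by nlinarith [hdesc k, sq_nonneg (D k)]) hθ'.le
  set A : ℝ := C / ((1 - θ) * a) with hA
  have hden : 0 < (1 - θ) * a := by positivity
  have hA0 : 0 ≤ A := by positivity
  have hstep : ∀ k, D (k + 1) ≤ (D k + s k) / 2 + A / 2 * (ψ (k + 1) - ψ (k + 2)) := by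
    intro k
    -- Weighted AM-GM replaces the concavity estimate for `t ^ (1 - θ)`; nothing is divided by `φ (k
    -- + 1) ^ θ`, so `φ` may vanish.
    have h1 := Real.geom_mean_le_arith_mean2_weighted hθ0.le hθ'.le (hφ (k + 1)) (hφ (k + 2))
      (by ring)
    have h2 : φ (k + 1) ^ θ * φ (k + 1) ^ (1 - θ) = φ (k + 1) := by
      rw [← Real.rpow_add_of_nonneg (hφ _) hθ0.le hθ'.le]; simp
    have h3 : (1 - θ) * (φ (k + 1) - φ (k + 2)) ≤ φ (k + 1) ^ θ * (ψ (k + 1) - ψ (k + 2)) := by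
      simp only [hψ]; rw [mul_sub (φ (k + 1) ^ θ), h2]; linarith
    have h4 : φ (k + 1) ^ θ * (ψ (k + 1) - ψ (k + 2)) ≤
        C * (D k + s k) * (ψ (k + 1) - ψ (k + 2)) :=
      mul_le_mul_of_nonneg_right (hKL k) (sub_nonneg.2 (hψanti (k + 1)))
    have h5 : (1 - θ) * (a * D (k + 1) ^ 2) ≤ (1 - θ) * (φ (k + 1) - φ (k + 2)) :=
      mul_le_mul_of_nonneg_left (by linarith [hdesc (k + 1)]) hθ'.le
    have h6 : D (k + 1) ^ 2 ≤ (D k + s k) * (A * (ψ (k + 1) - ψ (k + 2))) := by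
      have : D (k + 1) ^ 2 ≤ (C * (D k + s k) * (ψ (k + 1) - ψ (k + 2))) / ((1 - θ) * a) := by
        rw [le_div_iff₀ hden]; linarith
      refine this.trans_eq ?_
      rw [hA]; field_simp
    have h7 : 0 ≤ A * (ψ (k + 1) - ψ (k + 2)) := mul_nonneg hA0 (sub_nonneg.2 (hψanti (k + 1)))
    refine abs_le_of_sq_le_sq' ?_ ?_ |>.2
    · nlinarith [sq_nonneg ((D k + s k) - A * (ψ (k + 1) - ψ (k + 2)))]
    · have := hD k
      have := hs k
      linarith
  -- Summing `hstep` leaves half of `∑ D k` on the right; absorbing it on the left doubles the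
  -- remaining terms.
  refine summable_of_sum_range_le (c := 2 * D 0 + ∑' k, s k + A * ψ 1) hD fun n => ?_
  have h1 : ∑ k ∈ Finset.range n, D (k + 1) ≤
      ∑ k ∈ Finset.range n, ((D k + s k) / 2 + A / 2 * (ψ (k + 1) - ψ (k + 2))) :=
    Finset.sum_le_sum fun k _ => hstep k
  rw [Finset.sum_add_distrib, ← Finset.mul_sum, ← Finset.sum_div, Finset.sum_add_distrib,
    Finset.sum_range_sub' (fun k => ψ (k + 1)) n] at h1
  have h2 : ∑ k ∈ Finset.range n, s k ≤ ∑' k, s k := hsum.sum_le_tsum _ fun k _ => hs k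
  have h3 := Finset.sum_range_succ' D n
  have h4 := Finset.sum_range_succ D n
  have h5 := hD n
  have h6 := mul_nonneg hA0 (hψ0 (n + 1))
  simp only [zero_add] at h1
  nlinarith

/-! ### Convergence of abstract inexact descent sequences -/

section AbstractDescent

variable {E : Type*} [NormedAddCommGroup E] [InnerProductSpace ℝ E]

/-- The Łojasiewicz property, read off at points where the function is real and a subgradient is
known; the exponent may be increased as long as the values differ by at most one. -/
theorem LojasiewiczAt.exists_rpow_le {G : E → EReal} {f : E → ℝ} {K : Set E}
    (hG : ∀ x ∈ K, G x = f x) {x : E} (hx : x ∈ K) (hL : LojasiewiczAt G x) {θ₀ : ℝ}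
    (hθ₀ : 0 < θ₀) (hθ₀' : θ₀ < 1) :
    ∃ c : ℝ, 0 ≤ c ∧ ∃ θ : ℝ, θ₀ ≤ θ ∧ θ < 1 ∧ ∃ t ∈ 𝓝 x, ∀ y ∈ t, y ∈ K →
      ∀ u ∈ frechetSubdiff G y, |f y - f x| ≤ 1 → |f y - f x| ^ θ ≤ c * ‖u‖ := by
  obtain ⟨c, hc, θ, hθ0, hθ1, η, hη, hball⟩ := hL
  refine ⟨c, hc.le, max θ θ₀, le_max_right _ _, max_lt hθ1 hθ₀', Metric.ball x η,
    Metric.ball_mem_nhds _ hη, fun y hy hyK u hu h1 => ?_⟩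
  have hmpos : 0 < max θ θ₀ := hθ₀.trans_le (le_max_right _ _)
  -- Equal values are settled by the positive exponent `max θ θ₀`; otherwise `powZero` is an
  -- ordinary power.
  rcases (abs_nonneg (f y - f x)).eq_or_lt with h0 | h0
  · rw [← h0, Real.zero_rpow hmpos.ne']; positivity
  have hb := hball y hy
  rw [hG x hx, hG y hyK, ← EReal.coe_sub, EReal.abs_def, powZero,
    if_neg (by simpa using h0), ENNReal.ofReal_rpow_of_pos h0] at hb
  have h2 : Metric.infEDist 0 (frechetSubdiff G y) ≤ ENNReal.ofReal ‖u‖ := by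
    refine (Metric.infEDist_le_edist_of_mem hu).trans_eq ?_
    rw [edist_dist, dist_zero_left]
  have h3 := hb.trans (mul_le_mul_right h2 _)
  rw [← ENNReal.ofReal_mul hc.le, ENNReal.ofReal_le_ofReal_iff (by positivity)] at h3
  exact (Real.rpow_le_rpow_of_exponent_ge h0 h1 (le_max_left _ _)).trans h3

variable [CompleteSpace E]

/-- Abstract convergence of inexact descent sequences for `f + δ_K`, `K` compact, under the
Łojasiewicz property. Here `P k ∈ K` is a feasible point close to `z (k + 1)`, and `u k` is a
subgradient of `f + δ_K` at `P k`. -/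
theorem exists_tendsto_of_inexact_descent {G : E → EReal} {f : E → ℝ} {K : Set E}
    (hK : IsCompact K) (hf : Differentiable ℝ f) (hgrad : ContinuousOn (gradient f) K)
    (hG : ∀ x ∈ K, G x = f x)
    (hsub : ∀ x ∈ K, ∀ u, (∀ w ∈ K, inner ℝ (u - gradient f x) (w - x) ≤ 0) →
      u ∈ frechetSubdiff G x)
    (hKL : ∀ x, IsStationaryPt G x → LojasiewiczAt G x)
    {z P u : ℕ → E} {η β : ℕ → ℝ} {C a B θ₀ : ℝ} (hC : 0 ≤ C) (ha : 0 < a)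
    (hθ₀ : 0 < θ₀) (hθ₀' : θ₀ < 1)
    (hη0 : ∀ k, 0 ≤ η k) (hη : Summable η) (hβ0 : ∀ k, 0 ≤ β k)
    (hβ : Tendsto β atTop (𝓝 0)) (hβs : Summable fun k => β k ^ θ₀)
    (hP : ∀ k, P k ∈ K)
    (hu : ∀ k, ∀ w ∈ K, inner ℝ (u k - gradient f (P k)) (w - P k) ≤ 0)
    (hB : ∀ k, B ≤ f (z k))
    (hunorm : ∀ k, ‖u k‖ ≤ C * (‖z (k + 1) - z k‖ + η k))
    (hPz : ∀ k, ‖P k - z (k + 1)‖ ≤ C * η k)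
    (hfP : ∀ k, |f (P k) - f (z (k + 1))| ≤ C * (‖z (k + 1) - z k‖ ^ 2 + η k ^ 2))
    (hdesc : ∀ k, f (z (k + 1)) + β (k + 1) + a * ‖z (k + 1) - z k‖ ^ 2 ≤ f (z k) + β k) :
    ∃ x, IsStationaryPt G x ∧ Tendsto z atTop (𝓝 x) := by
  set D : ℕ → ℝ := fun k => ‖z (k + 1) - z k‖ with hDdef
  have hD0 : ∀ k, 0 ≤ D k := fun k => norm_nonneg _
  have hanti : Antitone fun k => f (z k) + β k :=
    antitone_nat_of_succ_le fun k => by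
      have := hdesc k
      have : 0 ≤ a * ‖z (k + 1) - z k‖ ^ 2 := by positivity
      linarith
  have hbdd : BddBelow (Set.range fun k => f (z k) + β k) :=
    ⟨B, by rintro _ ⟨k, rfl⟩; have := hB k; have := hβ0 k; simp only; linarith⟩
  obtain ⟨F, hF⟩ : ∃ F, Tendsto (fun k => f (z k) + β k) atTop (𝓝 F) :=
    ⟨_, tendsto_atTop_ciInf hanti hbdd⟩
  have hφ0 : ∀ k, 0 ≤ f (z k) + β k - F := fun k => sub_nonneg.2 (hanti.le_of_tendsto hF k)
  have hfz : Tendsto (fun k => f (z k)) atTop (𝓝 F) := by simpa using hF.sub hβ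
  have hDsq : Summable fun k => D k ^ 2 := by
    refine summable_of_sum_range_le (c := (f (z 0) + β 0 - F) / a) (fun k => sq_nonneg _)
      fun n => ?_
    rw [le_div_iff₀ ha]
    have h1 : ∑ k ∈ Finset.range n, D k ^ 2 * a ≤ ∑ k ∈ Finset.range n,
        ((f (z k) + β k) - (f (z (k + 1)) + β (k + 1))) :=
      Finset.sum_le_sum fun k _ => by have := hdesc k; simp only [hDdef]; linarith
    rw [← Finset.sum_mul, Finset.sum_range_sub' (fun k => f (z k) + β k)] at h1
    linarith [hφ0 n]
  have hDt : Tendsto D atTop (𝓝 0) := by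
    have := hDsq.tendsto_atTop_zero.sqrt
    simpa [Real.sqrt_sq, hD0] using this
  have hηt : Tendsto η atTop (𝓝 0) := hη.tendsto_atTop_zero
  have hut : Tendsto u atTop (𝓝 0) := by
    refine squeeze_zero_norm hunorm ?_
    simpa using (hDt.add hηt).const_mul C
  have hPzt : Tendsto (fun k => P k - z (k + 1)) atTop (𝓝 0) := by
    refine squeeze_zero_norm hPz ?_
    simpa using hηt.const_mul C
  have hfPt : Tendsto (fun k => f (P k)) atTop (𝓝 F) := by
    have h0 : Tendsto (fun k => f (P k) - f (z (k + 1))) atTop (𝓝 0) := by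
      refine squeeze_zero_norm hfP ?_
      simpa using ((hDt.pow 2).add (hηt.pow 2)).const_mul C
    simpa using h0.add (hfz.comp (tendsto_add_atTop_nat 1))
  -- Since `u k → 0`, the variational inequalities pass to the limit along an ultrafilter on which
  -- `P` converges.
  have hclust : ∀ x, MapClusterPt x atTop P → x ∈ K → f x = F ∧ IsStationaryPt G x := by
    intro x hx hxK
    obtain ⟨U, hU, hPU⟩ := mapClusterPt_iff_ultrafilter.1 hx
    refine ⟨tendsto_nhds_unique ((hf.continuous.tendsto x).comp hPU) (hfPt.mono_left hU), ?_⟩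
    refine hsub x hxK 0 fun w hw => ?_
    have hg : Tendsto (fun k => gradient f (P k)) U (𝓝 (gradient f x)) :=
      (hgrad x hxK).tendsto.comp
        (tendsto_nhdsWithin_iff.2 ⟨hPU, Eventually.of_forall hP⟩)
    exact le_of_tendsto (((hut.mono_left hU).sub hg).inner (tendsto_const_nhds.sub hPU))
      (Eventually.of_forall fun k => hu k w hw)
  -- Exponents of at least `1/2` turn squared errors into linear ones; exponents of at least `θ₀`
  -- make the powers of `β` summable.
  set θ₁ : ℝ := max θ₀ (1 / 2) with hθ₁
  have hθ₁0 : 0 < θ₁ := hθ₀.trans_le (le_max_left _ _)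
  have hθ₁1 : θ₁ < 1 := max_lt hθ₀' (by norm_num)
  have hsmall : ∀ᶠ k in atTop, |f (P k) - F| ≤ 1 := by
    have := (hfPt.sub_const F).abs
    simp only [sub_self, abs_zero] at this
    exact this.eventually_le_const one_pos
  -- Compactness induction over subsets of `K` gives one constant and one exponent. A cluster point
  -- of `P` is stationary with value `F`, so Łojasiewicz applies near it; any other point has a
  -- neighbourhood that `P` eventually avoids.
  obtain ⟨c, hc, θ, hθ1, hθ2, hev⟩ : ∃ c : ℝ, 0 ≤ c ∧ ∃ θ : ℝ, θ₁ ≤ θ ∧ θ < 1 ∧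
      ∀ᶠ k in atTop, P k ∈ K → |f (P k) - F| ^ θ ≤ c * ‖u k‖ := by
    refine hK.induction_on (p := fun s => ∃ c : ℝ, 0 ≤ c ∧ ∃ θ : ℝ, θ₁ ≤ θ ∧ θ < 1 ∧
      ∀ᶠ k in atTop, P k ∈ s → |f (P k) - F| ^ θ ≤ c * ‖u k‖) ?_ ?_ ?_ ?_
    · exact ⟨0, le_rfl, θ₁, le_rfl, hθ₁1, by simp⟩
    · rintro s t hst ⟨c, hc, θ, h1, h2, h3⟩
      exact ⟨c, hc, θ, h1, h2, h3.mono fun k hk hks => hk (hst hks)⟩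
    · rintro s t ⟨c, hc, θ, h1, h2, h3⟩ ⟨c', hc', θ', h1', h2', h3'⟩
      refine ⟨max c c', le_max_of_le_left hc, max θ θ', le_max_of_le_left h1, max_lt h2 h2', ?_⟩
      filter_upwards [h3, h3', hsmall] with k hk hk' hks hkst
      have hpos : 0 < max θ θ' := hθ₁0.trans_le (le_max_of_le_left h1)
      rcases (abs_nonneg (f (P k) - F)).eq_or_lt with h0 | h0
      · rw [← h0, Real.zero_rpow hpos.ne']
        exact mul_nonneg (le_max_of_le_left hc) (norm_nonneg _)
      rcases hkst with hkst | hkst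
      · exact (Real.rpow_le_rpow_of_exponent_ge h0 hks (le_max_left _ _)).trans
          ((hk hkst).trans (mul_le_mul_of_nonneg_right (le_max_left _ _) (norm_nonneg _)))
      · exact (Real.rpow_le_rpow_of_exponent_ge h0 hks (le_max_right _ _)).trans
          ((hk' hkst).trans (mul_le_mul_of_nonneg_right (le_max_right _ _) (norm_nonneg _)))
    · intro x hxK
      by_cases hx : MapClusterPt x atTop P
      · obtain ⟨hfx, hst⟩ := hclust x hx hxK
        obtain ⟨c, hc, θ, h1, h2, t, ht, h3⟩ :=
          (hKL x hst).exists_rpow_le hG hxK hθ₁0 hθ₁1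
        refine ⟨t, mem_nhdsWithin_of_mem_nhds ht, c, hc, θ, h1, h2, ?_⟩
        filter_upwards [hsmall] with k hk hkt
        rw [← hfx] at hk ⊢
        exact h3 _ hkt (hP k) _ (hsub _ (hP k) _ (hu k)) hk
      · rw [mapClusterPt_iff_frequently] at hx
        push Not at hx
        obtain ⟨t, ht, hev⟩ := hx
        refine ⟨t, mem_nhdsWithin_of_mem_nhds ht, 0, le_rfl, θ₁, le_rfl, hθ₁1, ?_⟩
        exact hev.mono fun k hk hkt => absurd hkt hk
  have hθ0 : 0 < θ := hθ₁0.trans_le hθ1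
  have hrpow_sq : ∀ d : ℝ, 0 ≤ d → d ≤ 1 → (d ^ 2) ^ θ ≤ d := by
    intro d hd0 hd1
    calc (d ^ 2) ^ θ ≤ (d ^ 2) ^ (1 / 2 : ℝ) :=
          Real.rpow_le_rpow_of_exponent_ge' (sq_nonneg d) (pow_le_one₀ hd0 hd1) (by norm_num)
            ((le_max_right _ _).trans hθ1)
      _ = d := by rw [← Real.sqrt_eq_rpow, Real.sqrt_sq hd0]
  have hkey : ∀ᶠ k in atTop, (f (z (k + 1)) + β (k + 1) - F) ^ θ ≤
      (c * C + C ^ θ + 1) * (D k + (η k + β (k + 1) ^ θ₀)) := by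
    filter_upwards [hev, hDt.eventually_le_const one_pos, hηt.eventually_le_const one_pos,
      (hβ.comp (tendsto_add_atTop_nat 1)).eventually_le_const one_pos] with k h1 h2 h3 h4
    simp only [Function.comp] at h4
    have hb : 0 ≤ C * (D k ^ 2 + η k ^ 2) := by positivity
    have hCθ : 0 ≤ C ^ θ := Real.rpow_nonneg hC _
    have hβθ : 0 ≤ β (k + 1) ^ θ₀ := Real.rpow_nonneg (hβ0 _) _
    -- The Łojasiewicz bound is known at `P k` only; passing to `z (k + 1)` costs second-order
    -- terms, and the power `θ ≤ 1` is then split by subadditivity.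
    have e1 : f (z (k + 1)) + β (k + 1) - F ≤
        |f (P k) - F| + C * (D k ^ 2 + η k ^ 2) + β (k + 1) := by
      have := (abs_le.1 (hfP k)).1
      have := le_abs_self (f (P k) - F)
      simp only [hDdef]
      linarith
    have e2 := Real.rpow_le_rpow (hφ0 (k + 1)) e1 hθ0.le
    have e3 := Real.rpow_add_le_add_rpow (add_nonneg (abs_nonneg (f (P k) - F)) hb)
      (hβ0 (k + 1)) hθ0.le hθ2.le
    have e4 := Real.rpow_add_le_add_rpow (abs_nonneg (f (P k) - F)) hb hθ0.le hθ2.le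
    have e5 : (C * (D k ^ 2 + η k ^ 2)) ^ θ ≤ C ^ θ * (D k + η k) := by
      rw [Real.mul_rpow hC (by positivity)]
      refine mul_le_mul_of_nonneg_left ?_ hCθ
      exact (Real.rpow_add_le_add_rpow (sq_nonneg _) (sq_nonneg _) hθ0.le hθ2.le).trans
        (add_le_add (hrpow_sq _ (hD0 k) h2) (hrpow_sq _ (hη0 k) h3))
    have e6 : β (k + 1) ^ θ ≤ β (k + 1) ^ θ₀ :=
      Real.rpow_le_rpow_of_exponent_ge' (hβ0 _) h4 hθ₀.le ((le_max_left _ _).trans hθ1)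
    have e7 : |f (P k) - F| ^ θ ≤ c * C * (D k + η k) := by
      refine (h1 (hP k)).trans ?_
      rw [mul_assoc]
      exact mul_le_mul_of_nonneg_left (hunorm k) hc
    have e8 : 0 ≤ (c * C + C ^ θ) * β (k + 1) ^ θ₀ := by positivity
    have := hD0 k
    have := hη0 k
    nlinarith
  have hDs : Summable D := by
    obtain ⟨N, hN⟩ := eventually_atTop.1 hkey
    refine (summable_nat_add_iff N).1 ?_
    refine summable_of_lojasiewicz_descent (φ := fun k => f (z (k + N)) + β (k + N) - F)
      (s := fun k => η (k + N) + β (k + N + 1) ^ θ₀) (C := c * C + C ^ θ + 1) ha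
      (by have := Real.rpow_nonneg hC θ; positivity) hθ0 hθ2 (fun k => hφ0 _) (fun k => hD0 _)
      (fun k => add_nonneg (hη0 _) (Real.rpow_nonneg (hβ0 _) _)) ?_ ?_ ?_
    · refine Summable.add ((summable_nat_add_iff N).2 hη) ?_
      simpa only [add_assoc] using (summable_nat_add_iff (N + 1)).2 hβs
    · intro k
      have := hdesc (k + N)
      simp only [hDdef]
      rw [add_right_comm k 1 N]
      linarith
    · intro k
      have := hN (k + N) (Nat.le_add_left _ _)
      rwa [add_right_comm k 1 N]
  obtain ⟨x, hx⟩ := cauchySeq_tendsto_of_complete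
    (cauchySeq_of_summable_dist (f := z) (hDs.congr fun k => by rw [dist_comm, dist_eq_norm]))
  have hPx : Tendsto P atTop (𝓝 x) := by
    simpa using hPzt.add (hx.comp (tendsto_add_atTop_nat 1))
  exact ⟨x, (hclust x hPx.mapClusterPt (hK.isClosed.mem_of_tendsto hPx
    (Eventually.of_forall hP))).2, hx⟩

end AbstractDescent

/-! ### Convex constraints, error bounds and the KKT residual -/

theorem ConvexOn.add_inner_gradient_le {E : Type*} [NormedAddCommGroup E] [InnerProductSpace ℝ E]
    [CompleteSpace E] {g : E → ℝ} (hg : ConvexOn ℝ Set.univ g) {x : E}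
    (hd : DifferentiableAt ℝ g x) (y : E) : g x + inner ℝ (gradient g x) (y - x) ≤ g y := by
  have h1 : ConvexOn ℝ Set.univ (g ∘ (AffineMap.lineMap x y : ℝ →ᵃ[ℝ] E)) := by
    simpa using hg.comp_affineMap (AffineMap.lineMap x y : ℝ →ᵃ[ℝ] E)
  have h2 : HasDerivAt (g ∘ (AffineMap.lineMap x y : ℝ →ᵃ[ℝ] E))
      (inner ℝ (gradient g x) (y - x)) 0 := by
    have h3 : HasFDerivAt g (InnerProductSpace.toDual ℝ E (gradient g x))
        ((AffineMap.lineMap x y : ℝ →ᵃ[ℝ] E) 0) := by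
      simpa using hd.hasGradientAt.hasFDerivAt
    simpa using h3.comp_hasDerivAt (0 : ℝ) AffineMap.hasDerivAt_lineMap
  have h4 := h1.le_slope_of_hasDerivAt (Set.mem_univ _) (Set.mem_univ _) one_pos h2
  simp only [slope_def_field, Function.comp, AffineMap.lineMap_apply_zero,
    AffineMap.lineMap_apply_one, sub_zero, div_one] at h4
  linarith

theorem EuclideanSpace.norm_le_mul_norm_of_abs_le {q : ℕ} {u v : EuclideanSpace ℝ (Fin q)} {t : ℝ}
    (ht : 0 ≤ t) (h : ∀ j, |u j| ≤ t * |v j|) : ‖u‖ ≤ t * ‖v‖ := by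
  rw [EuclideanSpace.norm_eq, EuclideanSpace.norm_eq]
  rw [← Real.sqrt_sq ht, ← Real.sqrt_mul (sq_nonneg t), Finset.mul_sum]
  refine Real.sqrt_le_sqrt (Finset.sum_le_sum fun j _ => ?_)
  rw [← mul_pow, Real.norm_eq_abs, Real.norm_eq_abs]
  exact pow_le_pow_left₀ (abs_nonneg _) (h j) 2

theorem EuclideanSpace.norm_le_sqrt_mul_norm_ofLp {q : ℕ} (u : EuclideanSpace ℝ (Fin q)) :
    ‖u‖ ≤ √q * ‖u.ofLp‖ := by
  rw [EuclideanSpace.norm_eq, ← Real.sqrt_sq (norm_nonneg u.ofLp), ← Real.sqrt_mul (by positivity)]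
  refine Real.sqrt_le_sqrt ?_
  calc ∑ i, ‖u i‖ ^ 2 ≤ ∑ _i : Fin q, ‖u.ofLp‖ ^ 2 :=
        Finset.sum_le_sum fun i _ => pow_le_pow_left₀ (norm_nonneg _) (norm_le_pi_norm u.ofLp i) 2
    _ = _ := by simp

/-- For convex constraints, an error bound near the feasible set is an error bound everywhere. -/
theorem HoffmanBoundOn.univ {E : Type*} [NormedAddCommGroup E] [NormedSpace ℝ E] {q : ℕ}
    {g : Fin q → E → ℝ} (hg : ∀ j, ConvexOn ℝ Set.univ (g j)) (hS : IsCompact (feasSet g))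
    (hne : (feasSet g).Nonempty) {r : ℝ} (hr : 0 < r)
    (H : HoffmanBoundOn g (enlarge r (feasSet g))) : HoffmanBoundOn g Set.univ := by
  obtain ⟨c, hc, H⟩ := H
  refine ⟨c, hc, fun w _ => ?_⟩
  by_cases hw : Metric.infDist w (feasSet g) ≤ r
  · exact H w hw
  push Not at hw
  obtain ⟨y, hy, hyd⟩ := hS.exists_infDist_eq_dist hne w
  set d := Metric.infDist w (feasSet g) with hd
  have hd0 : 0 < d := hr.trans hw
  -- The point `v` on the segment from the nearest point `y` to `w` lies at distance `r` from `y`,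
  -- so the local bound applies there. Convexity and `g j y ≤ 0` shrink the violation by at least
  -- the factor `t`, while the distance at `v` is still at least `t * d`.
  set t := r / d with ht
  have ht0 : 0 < t := div_pos hr hd0
  have ht1 : t ≤ 1 := (div_le_one hd0).2 hw.le
  have htd : t * d = r := div_mul_cancel₀ r hd0.ne'
  set v := AffineMap.lineMap y w t with hv
  have hvy : dist v y = t * d := by
    rw [hv, dist_lineMap_left, hyd, dist_comm, Real.norm_of_nonneg ht0.le]
  have hvw : dist w v = (1 - t) * d := by
    rw [hv, dist_comm, dist_lineMap_right, hyd, dist_comm, Real.norm_of_nonneg (by linarith)]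
  have hvr : Metric.infDist v (feasSet g) ≤ r :=
    (Metric.infDist_le_dist_of_mem hy).trans (by linarith)
  have h1 := H v hvr
  have h2 : d ≤ Metric.infDist v (feasSet g) + dist w v := Metric.infDist_le_infDist_add_dist
  have h3 : ‖posPartVec g v‖ ≤ t * ‖posPartVec g w‖ := by
    refine EuclideanSpace.norm_le_mul_norm_of_abs_le ht0.le fun j => ?_
    simp only [posPartVec]
    rw [abs_of_nonneg (le_max_right _ _), abs_of_nonneg (le_max_right _ _)]
    refine max_le ?_ (mul_nonneg ht0.le (le_max_right _ _))
    have h4 := (hg j).2 (Set.mem_univ y) (Set.mem_univ w) (sub_nonneg.2 ht1) ht0.le (by ring)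
    rw [← AffineMap.lineMap_apply_module] at h4
    have h5 := mul_nonneg (sub_nonneg.2 ht1) (neg_nonneg.2 (hy j))
    have h6 := mul_le_mul_of_nonneg_left (le_max_left (g j w) 0) ht0.le
    simp only [smul_eq_mul] at h4
    linarith
  have h4 : t * d ≤ t * (c * ‖posPartVec g w‖) := by
    have := mul_le_mul_of_nonneg_left h3 hc
    nlinarith
  exact le_of_mul_le_mul_left h4 ht0

/-- A point with small residual is nearly feasible and nearly satisfies the variational inequality
of the projection onto the feasible set. -/
theorem exists_bound_of_kktResidual_le {d q : ℕ} {g : Fin q → EuclideanSpace ℝ (Fin d) → ℝ}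
    (hg : ∀ j, ConvexOn ℝ Set.univ (g j)) (hdiff : ∀ j, Differentiable ℝ (g j))
    (hS : IsCompact (feasSet g)) (H : HoffmanBoundOn g Set.univ) :
    ∃ C : ℝ, 0 ≤ C ∧ ∀ x lam xt κ, (∀ j, 0 ≤ lam j) → kktResidual g x lam xt ≤ κ →
      Metric.infDist x (feasSet g) ≤ C * κ ∧
        ∀ w ∈ feasSet g, inner ℝ (xt - x) (w - x) ≤ C * κ := by
  obtain ⟨c, hc, H⟩ := H
  obtain ⟨R, hR⟩ := hS.isBounded.exists_norm_le
  set R' := max R 0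
  have hR'0 : 0 ≤ R' := le_max_right _ _
  refine ⟨c * √q + (1 + √d * R'), by positivity, fun x lam xt κ hlam hres => ?_⟩
  set v := kktVec g x lam xt with hv
  have t1 := le_max_right (inner ℝ x v : ℝ) 0
  have t2 := norm_nonneg (WithLp.ofLp v : Fin d → ℝ)
  have t3 := norm_nonneg (fun j => max (g j x) 0 : Fin q → ℝ)
  have t4 := le_max_right (-∑ j, lam j * g j x) 0
  have t1' := le_max_left (inner ℝ x v : ℝ) 0
  have t4' := le_max_left (-∑ j, lam j * g j x) 0
  unfold kktResidual at hres
  rw [← hv] at hres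
  have hκ : 0 ≤ κ := by linarith
  constructor
  · have h1 := H x (Set.mem_univ x)
    have h2 := EuclideanSpace.norm_le_sqrt_mul_norm_ofLp (posPartVec g x)
    have h3 : ‖(posPartVec g x).ofLp‖ ≤ κ := by
      have : ‖(posPartVec g x).ofLp‖ = ‖(fun j => max (g j x) 0 : Fin q → ℝ)‖ := rfl
      linarith
    calc Metric.infDist x (feasSet g) ≤ c * (√q * κ) :=
          h1.trans (mul_le_mul_of_nonneg_left
            (h2.trans (mul_le_mul_of_nonneg_left h3 (Real.sqrt_nonneg _))) hc)
      _ = c * √q * κ := by ring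
      _ ≤ _ := mul_le_mul_of_nonneg_right (le_add_of_nonneg_right (by positivity)) hκ
  · intro w hw
    -- Multiplier-weighted gradient inequalities at a feasible `w`. What remains is `-⟨lam, g x⟩ +
    -- ⟨x, v⟩ - ⟨v, w⟩`: the first two terms are controlled by the residual itself and the last by
    -- boundedness of the feasible set, so no bound on `x` or `lam` is needed.
    have h1 : ∑ j, lam j * g j x + inner ℝ (∑ j, lam j • gradient (g j) x) (w - x) ≤ 0 := by
      rw [sum_inner, ← Finset.sum_add_distrib]
      refine Finset.sum_nonpos fun j _ => ?_
      rw [inner_smul_left, RCLike.conj_to_real, ← mul_add]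
      exact mul_nonpos_of_nonneg_of_nonpos (hlam j)
        (((hg j).add_inner_gradient_le (hdiff j x) w).trans (hw j))
    have h2 : xt - x = (∑ j, lam j • gradient (g j) x) - v := by
      rw [hv, kktVec]; abel
    have h3 : -inner ℝ v w ≤ √d * R' * ‖v.ofLp‖ := by
      calc -inner ℝ v w ≤ ‖v‖ * ‖w‖ := (neg_le_abs _).trans (abs_real_inner_le_norm v w)
        _ ≤ (√d * ‖v.ofLp‖) * R' := mul_le_mul (EuclideanSpace.norm_le_sqrt_mul_norm_ofLp v)
            ((hR w hw).trans (le_max_left _ _)) (norm_nonneg _) (by positivity)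
        _ = _ := by ring
    have h4 : √d * R' * ‖v.ofLp‖ ≤ √d * R' * (κ - max (inner ℝ x v) 0 -
        max (-∑ j, lam j * g j x) 0) :=
      mul_le_mul_of_nonneg_left (by linarith) (by positivity)
    have h5 : √d * R' * (κ - max (inner ℝ x v) 0 - max (-∑ j, lam j * g j x) 0) ≤ √d * R' * κ :=
      mul_le_mul_of_nonneg_left (by linarith) (by positivity)
    have h6 : 0 ≤ c * √q * κ := by positivity
    rw [h2, inner_sub_left, inner_sub_right v, real_inner_comm x v]
    linarith

/-! ### Inexact projected gradient steps -/

section Projection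

variable {E : Type*} [NormedAddCommGroup E] [InnerProductSpace ℝ E]

theorem exists_projection_of_isCompact {S : Set E} (hS : IsCompact S) (hne : S.Nonempty)
    (hc : Convex ℝ S) (x : E) : ∃ P ∈ S, ∀ w ∈ S, inner ℝ (x - P) (w - P) ≤ 0 := by
  obtain ⟨P, hP, h⟩ := exists_norm_eq_iInf_of_complete_convex hne hS.isComplete hc x
  exact ⟨P, hP, (norm_eq_iInf_iff_real_inner_le_zero hc hP).1 h⟩

/-- Estimates for one inexact projected gradient step `x ↦ y` with step size `1 / s` and gradient
`v`, on a ball of diameter `B`. -/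
theorem inexact_projection_step {S : Set E} (hS : IsCompact S) (hne : S.Nonempty)
    (hc : Convex ℝ S) {x y v : E} {s l M R κ κ₀ : ℝ} (hl : 0 < l) (hsl : l ≤ s) (hsM : s ≤ M)
    (hxS : Metric.infDist x S ≤ κ₀) (hyS : Metric.infDist y S ≤ κ)
    (hR : ∀ w ∈ S, ‖x - (1 / s) • v - w‖ ≤ R) (hRy : ‖x - (1 / s) • v - y‖ ≤ R)
    (hvi : ∀ w ∈ S, inner ℝ (x - (1 / s) • v - y) (w - y) ≤ κ) :
    inner ℝ v (y - x) + s * ‖y - x‖ ^ 2 ≤ M * (1 + R) * (κ + κ₀) ∧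
      ∃ P ∈ S, (∀ w ∈ S, inner ℝ (x - (1 / s) • v - P) (w - P) ≤ 0) ∧
        ‖P - y‖ ^ 2 ≤ (1 + R) * κ ∧
        |inner ℝ v (P - y)| ≤ M * (‖y - x‖ ^ 2 + 3 * ((1 + R) * κ)) := by
  have hs : 0 < s := hl.trans_le hsl
  set xt := x - (1 / s) • v with hxt
  have hv : v = s • (x - xt) := by
    rw [hxt, sub_sub_cancel, smul_smul, mul_one_div_cancel hs.ne', one_smul]
  have hR0 : 0 ≤ R := (norm_nonneg _).trans hRy
  have hκ : 0 ≤ κ := Metric.infDist_nonneg.trans hyS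
  have hκ₀ : 0 ≤ κ₀ := Metric.infDist_nonneg.trans hxS
  constructor
  -- The old point `x` may be infeasible, so the inequality is tested at its nearest feasible point,
  -- at a cost of `R * κ₀`.
  · obtain ⟨w, hw, hwd⟩ := hS.exists_infDist_eq_dist hne x
    have h1 := hvi w hw
    have h2 : inner ℝ (xt - y) (x - w) ≤ R * κ₀ := by
      refine (real_inner_le_norm _ _).trans (mul_le_mul hRy ?_ (norm_nonneg _) hR0)
      rw [← dist_eq_norm, ← hwd]; exact hxS
    have h3 : inner ℝ (xt - y) (x - y) ≤ κ + R * κ₀ := by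
      have : x - y = (w - y) + (x - w) := by abel
      rw [this, inner_add_right]; linarith
    have h4 : inner ℝ v (y - x) + s * ‖y - x‖ ^ 2 = s * inner ℝ (xt - y) (x - y) := by
      rw [hv, inner_smul_left, RCLike.conj_to_real, ← real_inner_self_eq_norm_sq, ← mul_add,
        ← inner_add_left, ← inner_neg_neg]
      congr 2 <;> abel
    rw [h4]
    have h5 : κ + R * κ₀ ≤ (1 + R) * (κ + κ₀) := by nlinarith [mul_nonneg hR0 hκ]
    have h6 : 0 ≤ (1 + R) * (κ + κ₀) := by positivity
    nlinarith [mul_le_mul_of_nonneg_left (h3.trans h5) hs.le]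
  -- The inequality of `P` is tested at the feasible point nearest to `y`, and that of `y` at `P`;
  -- together they give `‖P - y‖² = O(κ)`.
  · obtain ⟨P, hP, hPvi⟩ := exists_projection_of_isCompact hS hne hc xt
    obtain ⟨w, hw, hwd⟩ := hS.exists_infDist_eq_dist hne y
    have h1 : -(R * κ) ≤ inner ℝ (xt - P) (P - y) := by
      have e1 := hPvi w hw
      have e2 : inner ℝ (xt - P) (y - w) ≤ R * κ := by
        refine (real_inner_le_norm _ _).trans (mul_le_mul (hR P hP) ?_ (norm_nonneg _) hR0)
        rw [← dist_eq_norm, ← hwd]; exact hyS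
      have e3 : P - y = -((w - P) + (y - w)) := by abel
      rw [e3, inner_neg_right, inner_add_right]; linarith
    have h2 : inner ℝ (xt - P) (P - y) + ‖P - y‖ ^ 2 ≤ κ := by
      have e1 := hvi P hP
      have e2 : xt - y = (xt - P) + (P - y) := by abel
      rwa [e2, inner_add_left, real_inner_self_eq_norm_sq] at e1
    have h3 : ‖P - y‖ ^ 2 ≤ (1 + R) * κ := by linarith
    refine ⟨P, hP, hPvi, h3, ?_⟩
    -- Cauchy–Schwarz on `v` would only give `O(√κ)`. Splitting `v` through `P` leaves one term
    -- already bounded by `O(κ)` and one product of two small vectors.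
    have h4 : inner ℝ v (P - y) = s * (inner ℝ (x - P) (P - y) - inner ℝ (xt - P) (P - y)) := by
      rw [hv, inner_smul_left, RCLike.conj_to_real, ← inner_sub_left]
      congr 2; abel
    have h5 : |inner ℝ (xt - P) (P - y)| ≤ (1 + R) * κ :=
      abs_le.2 ⟨by linarith, by nlinarith [sq_nonneg ‖P - y‖]⟩
    have h6 : |inner ℝ (x - P) (P - y)| ≤ ‖y - x‖ ^ 2 + 2 * ‖P - y‖ ^ 2 := by
      have e1 : ‖x - P‖ ≤ ‖y - x‖ + ‖P - y‖ := by
        rw [← norm_neg (y - x), ← norm_neg (P - y)]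
        refine (norm_add_le _ _).trans_eq' ?_
        congr 1; abel
      have e2 := (abs_real_inner_le_norm (x - P) (P - y)).trans
        (mul_le_mul_of_nonneg_right e1 (norm_nonneg _))
      nlinarith [sq_nonneg (‖y - x‖ - ‖P - y‖), norm_nonneg (P - y), norm_nonneg (y - x)]
    rw [h4, abs_mul, abs_of_pos hs]
    refine mul_le_mul hsM ((abs_sub _ _).trans ?_) (abs_nonneg _) (hs.le.trans hsM)
    linarith

end Projection

/-! ### Norms and compactness in products of blocks; enlargements -/

section BlockNorm

variable {ι : Type*} [Fintype ι] {β : ι → Type*} [∀ i, NormedAddCommGroup (β i)]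

theorem PiLp.norm_le_norm_of_forall_norm_le {a b : PiLp 2 β} (h : ∀ i, ‖a i‖ ≤ ‖b i‖) :
    ‖a‖ ≤ ‖b‖ := by
  refine abs_le_of_sq_le_sq' ?_ (norm_nonneg b) |>.2
  rw [PiLp.norm_sq_eq_of_L2, PiLp.norm_sq_eq_of_L2]
  exact Finset.sum_le_sum fun i _ => pow_le_pow_left₀ (norm_nonneg _) (h i) 2

theorem PiLp.norm_le_sum_norm (a : PiLp 2 β) : ‖a‖ ≤ ∑ i, ‖a i‖ := by
  refine abs_le_of_sq_le_sq' ?_ (Finset.sum_nonneg fun i _ => norm_nonneg _) |>.2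
  rw [PiLp.norm_sq_eq_of_L2]
  exact Finset.sum_sq_le_sq_sum_of_nonneg fun i _ => norm_nonneg _

end BlockNorm

theorem PiLp.isCompact_setOf_forall_mem {ι : Type*} {β : ι → Type*}
    [∀ i, NormedAddCommGroup (β i)] {S : ∀ i, Set (β i)} (hS : ∀ i, IsCompact (S i)) :
    IsCompact {z : PiLp 2 β | ∀ i, z i ∈ S i} := by
  have h := (isCompact_univ_pi hS).image (PiLp.continuous_toLp 2 β)
  convert h using 1
  ext z
  constructor
  · intro hz
    exact ⟨WithLp.ofLp z, fun i _ => hz i, rfl⟩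
  · rintro ⟨y, hy, rfl⟩ i
    exact hy i trivial

theorem enlarge_eq_cthickening {E : Type*} [PseudoMetricSpace E] {S : Set E} (hS : S.Nonempty)
    {r : ℝ} (hr : 0 ≤ r) : enlarge r S = Metric.cthickening r S := by
  ext w
  rw [enlarge, Metric.mem_cthickening_iff, Set.mem_ofPred_eq, Metric.infDist,
    ENNReal.le_ofReal_iff_toReal_le (Metric.infEDist_ne_top hS) hr]

theorem subset_enlarge {E : Type*} [PseudoMetricSpace E] (S : Set E) {r : ℝ} (hr : 0 ≤ r) :
    S ⊆ enlarge r S := fun w hw => by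
  rw [enlarge, Set.mem_ofPred_eq, Metric.infDist_zero_of_mem hw]; exact hr

/-! ### The block-structured problem -/

section Blocks

variable {n : ℕ} {m p : Fin n → ℕ}

/-- The feasible set of the block-structured problem. -/
def prodFeas (h : ∀ i, Fin (p i) → Blk m i → ℝ) : Set (BlockSpace m) :=
  {z | ∀ i, z i ∈ feasSet (h i)}

theorem extObjective_of_mem {f : BlockSpace m → ℝ} {h : ∀ i, Fin (p i) → Blk m i → ℝ}
    {z : BlockSpace m} (hz : z ∈ prodFeas h) : extObjective f h z = f z := by
  have : ∀ i, setIndicator (feasSet (h i)) (z i) = 0 := fun i => if_pos (hz i)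
  simp [extObjective, this]

theorem extObjective_of_notMem {f : BlockSpace m → ℝ} {h : ∀ i, Fin (p i) → Blk m i → ℝ}
    {z : BlockSpace m} (hz : z ∉ prodFeas h) : extObjective f h z = ⊤ := by
  obtain ⟨i, hi⟩ : ∃ i, z i ∉ feasSet (h i) := by simpa [prodFeas] using hz
  have h0 : ∀ j ∈ Finset.univ, 0 ≤ setIndicator (feasSet (h j)) (z j) := fun j _ => by
    unfold setIndicator; split_ifs <;> simp
  have h1 := Finset.single_le_sum h0 (Finset.mem_univ i)
  have h2 : setIndicator (feasSet (h i)) (z i) = ⊤ := if_neg hi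
  rw [h2, top_le_iff] at h1
  rw [extObjective, h1, EReal.coe_add_top]

/-- At feasible `y` the variational inequality discards the normal part `u - ∇f(x)` and
differentiability leaves `o(‖y - x‖)`; at infeasible `y` the quotient is `⊤`. -/
theorem mem_frechetSubdiff_extObjective {f : BlockSpace m → ℝ} (hf : Differentiable ℝ f)
    {h : ∀ i, Fin (p i) → Blk m i → ℝ} {x u : BlockSpace m} (hx : x ∈ prodFeas h)
    (hu : ∀ w ∈ prodFeas h, inner ℝ (u - gradient f x) (w - x) ≤ 0) :
    u ∈ frechetSubdiff (extObjective f h) x := by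
  refine ⟨by rw [extObjective_of_mem hx]; exact EReal.coe_ne_top _, ?_⟩
  refine le_of_forall_lt_imp_le_of_dense fun c hc => ?_
  induction c with
  | top => simp at hc
  | bot => exact bot_le
  | coe c =>
    have hc0 : 0 < -c := neg_pos.2 (by exact_mod_cast hc)
    have ho := (hasGradientAt_iff_isLittleO.1 (hf x).hasGradientAt).def hc0
    refine le_liminf_of_le (by isBoundedDefault) ?_
    filter_upwards [nhdsWithin_le_nhds ho, self_mem_nhdsWithin] with y hy hyx
    have hpos : 0 < ‖y - x‖ := norm_pos_iff.2 (sub_ne_zero.2 hyx)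
    rw [extObjective_of_mem hx]
    by_cases hyK : y ∈ prodFeas h
    · rw [extObjective_of_mem hyK, ← EReal.coe_sub, ← EReal.coe_sub, ← EReal.coe_div,
        EReal.coe_le_coe_iff, le_div_iff₀ hpos]
      have h1 := hu y hyK
      rw [inner_sub_left] at h1
      have h2 := (abs_le.1 hy).1
      linarith
    · rw [extObjective_of_notMem hyK, EReal.top_sub_coe, EReal.top_sub_coe,
        EReal.top_div_of_pos_ne_top (by exact_mod_cast hpos) (EReal.coe_ne_top _)]
      exact le_top

theorem isCompact_prodFeas {h : ∀ i, Fin (p i) → Blk m i → ℝ}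
    (hS : ∀ i, IsCompact (feasSet (h i))) : IsCompact (prodFeas h) :=
  PiLp.isCompact_setOf_forall_mem hS

theorem isCompact_enlargedFeas {h : ∀ i, Fin (p i) → Blk m i → ℝ} {r : ℝ} (hr : 0 ≤ r)
    (hne : ∀ i, (feasSet (h i)).Nonempty) (hS : ∀ i, IsCompact (feasSet (h i))) :
    IsCompact (enlargedFeas h r) :=
  PiLp.isCompact_setOf_forall_mem fun i => by
    rw [enlarge_eq_cthickening (hne i) hr]; exact (hS i).cthickening

theorem convex_enlargedFeas {h : ∀ i, Fin (p i) → Blk m i → ℝ} {r : ℝ} (hr : 0 ≤ r)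
    (hne : ∀ i, (feasSet (h i)).Nonempty) (hS : ∀ i, Convex ℝ (feasSet (h i))) :
    Convex ℝ (enlargedFeas h r) := by
  intro x hx y hy a b ha hb hab i
  have : Convex ℝ (enlarge r (feasSet (h i))) := by
    rw [enlarge_eq_cthickening (hne i) hr]; exact (hS i).cthickening r
  exact this (hx i) (hy i) ha hb hab

theorem prodFeas_subset_enlargedFeas (h : ∀ i, Fin (p i) → Blk m i → ℝ) {r : ℝ} (hr : 0 ≤ r) :
    prodFeas h ⊆ enlargedFeas h r := fun _ hz i => subset_enlarge _ hr (hz i)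

theorem norm_gradient_sub_le {f : BlockSpace m → ℝ} {T : Set (BlockSpace m)} {L : Fin n → ℝ}
    (hL : ∀ i, ∀ a ∈ T, ∀ b ∈ T, ‖blockGrad f i a - blockGrad f i b‖ ≤ L i * ‖a - b‖)
    {a b : BlockSpace m} (ha : a ∈ T) (hb : b ∈ T) :
    ‖gradient f a - gradient f b‖ ≤ (∑ i, L i) * ‖a - b‖ := by
  refine (PiLp.norm_le_sum_norm _).trans ?_
  rw [Finset.sum_mul]
  exact Finset.sum_le_sum fun i _ => hL i a ha b hb

theorem exists_sub_eq_inner_gradient {E : Type*} [NormedAddCommGroup E] [InnerProductSpace ℝ E]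
    [CompleteSpace E] {f : E → ℝ} (hf : Differentiable ℝ f) {T : Set E} (hT : Convex ℝ T)
    {a b : E} (ha : a ∈ T) (hb : b ∈ T) :
    ∃ c ∈ T, ‖c - a‖ ≤ ‖b - a‖ ∧ f b - f a = inner ℝ (gradient f c) (b - a) := by
  obtain ⟨c, hc, h⟩ := domain_mvt (f := f) (s := segment ℝ a b)
    (f' := fun x => InnerProductSpace.toDual ℝ E (gradient f x))
    (fun x _ => (hf x).hasGradientAt.hasFDerivAt.hasFDerivWithinAt)
    (convex_segment a b) (left_mem_segment ℝ a b) (right_mem_segment ℝ a b)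
  exact ⟨c, hT.segment_subset ha hb hc, norm_sub_le_of_mem_segment hc, h⟩

theorem abs_sub_sub_inner_gradient_le {E : Type*} [NormedAddCommGroup E] [InnerProductSpace ℝ E]
    [CompleteSpace E] {f : E → ℝ} (hf : Differentiable ℝ f) {T : Set E} (hT : Convex ℝ T) {Λ : ℝ}
    (hΛ0 : 0 ≤ Λ) (hΛ : ∀ a ∈ T, ∀ b ∈ T, ‖gradient f a - gradient f b‖ ≤ Λ * ‖a - b‖)
    {a b : E} (ha : a ∈ T) (hb : b ∈ T) :
    |f b - f a - inner ℝ (gradient f a) (b - a)| ≤ Λ * ‖b - a‖ ^ 2 := by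
  obtain ⟨c, hc, hca, h⟩ := exists_sub_eq_inner_gradient hf hT ha hb
  rw [h, ← inner_sub_left]
  refine (abs_real_inner_le_norm _ _).trans ?_
  rw [sq, ← mul_assoc]
  exact mul_le_mul_of_nonneg_right
    ((hΛ c hc a ha).trans (mul_le_mul_of_nonneg_left hca hΛ0)) (norm_nonneg _)

/-- The mean value theorem gives the constant `l` instead of the sharp `l / 2`. This suffices,
because the variational inequality of the step supplies the full term `s * ‖y - x‖ ^ 2`. -/
theorem sub_le_of_eq_off_block {f : BlockSpace m → ℝ} (hf : Differentiable ℝ f)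
    {T : Set (BlockSpace m)} (hT : Convex ℝ T) {i : Fin n} {l : ℝ} (hl : 0 ≤ l)
    (hL : ∀ a ∈ T, ∀ b ∈ T, ‖blockGrad f i a - blockGrad f i b‖ ≤ l * ‖a - b‖)
    {a b : BlockSpace m} (ha : a ∈ T) (hb : b ∈ T) (hab : ∀ j, j ≠ i → a j = b j) :
    f b - f a ≤ inner ℝ (blockGrad f i a) (b i - a i) + l * ‖b i - a i‖ ^ 2 := by
  obtain ⟨c, hc, hca, h⟩ := exists_sub_eq_inner_gradient hf hT ha hb
  have h0 : ∀ j, j ≠ i → (b - a) j = 0 := fun j hj => by simp [hab j hj]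
  have h1 : inner ℝ (gradient f c) (b - a) = inner ℝ (blockGrad f i c) (b i - a i) := by
    rw [PiLp.inner_apply, Finset.sum_eq_single i (fun j _ hj => by rw [h0 j hj, inner_zero_right])
      (by simp)]
    rfl
  have h2 : ‖b - a‖ = ‖b i - a i‖ := by
    rw [← sq_eq_sq₀ (norm_nonneg _) (norm_nonneg _), PiLp.norm_sq_eq_of_L2,
      Finset.sum_eq_single i (fun j _ hj => by rw [h0 j hj]; simp) (by simp)]
    rfl
  have h3 : inner ℝ (blockGrad f i c - blockGrad f i a) (b i - a i) ≤ l * ‖b i - a i‖ ^ 2 := by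
    refine (real_inner_le_norm _ _).trans ?_
    rw [sq, ← mul_assoc]
    exact mul_le_mul_of_nonneg_right
      ((hL c hc a ha).trans (mul_le_mul_of_nonneg_left (hca.trans_eq h2) hl)) (norm_nonneg _)
  rw [inner_sub_left] at h3
  rw [h, h1]
  linarith

/-- The first `j` blocks from `u`, the others from `v`. -/
def takeBlocks (j : ℕ) (u v : BlockSpace m) : BlockSpace m :=
  WithLp.toLp 2 (fun i => if (i : ℕ) < j then u i else v i)

theorem takeBlocks_mem {S : ∀ i, Set (Blk m i)} (j : ℕ) {u v : BlockSpace m}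
    (hu : ∀ i, u i ∈ S i) (hv : ∀ i, v i ∈ S i) (i : Fin n) : takeBlocks j u v i ∈ S i := by
  simp only [takeBlocks]
  split_ifs
  exacts [hu i, hv i]

theorem norm_sub_takeBlocks_le (j : ℕ) (u v : BlockSpace m) :
    ‖u - takeBlocks j u v‖ ≤ ‖u - v‖ := by
  refine PiLp.norm_le_norm_of_forall_norm_le fun i => ?_
  simp only [takeBlocks, PiLp.sub_apply]
  split_ifs <;> simp

/-- Blockwise descent estimates add up. -/
theorem sub_le_sum_blocks {f : BlockSpace m → ℝ} (hf : Differentiable ℝ f)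
    {S : ∀ i, Set (Blk m i)} (hT : Convex ℝ {z : BlockSpace m | ∀ i, z i ∈ S i}) {L : Fin n → ℝ}
    (hL0 : ∀ i, 0 ≤ L i)
    (hL : ∀ i, ∀ a ∈ {z : BlockSpace m | ∀ i, z i ∈ S i},
      ∀ b ∈ {z : BlockSpace m | ∀ i, z i ∈ S i},
      ‖blockGrad f i a - blockGrad f i b‖ ≤ L i * ‖a - b‖)
    {x y : BlockSpace m} (hx : ∀ i, x i ∈ S i) (hy : ∀ i, y i ∈ S i) :
    f y - f x ≤ ∑ i, (inner ℝ (blockGrad f i (mixBlocks i y x)) (y i - x i)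
      + L i * ‖y i - x i‖ ^ 2) := by
  -- The path from `x` to `y` changes one block at a time, and the differences of `f` along it
  -- telescope.
  have h0 : takeBlocks 0 y x = x := by ext i; simp [takeBlocks]
  have hn : takeBlocks n y x = y := by ext i; simp [takeBlocks]
  have h1 := Finset.sum_range_sub (fun j => f (takeBlocks j y x)) n
  simp only [h0, hn] at h1
  rw [← h1, Finset.sum_range]
  refine Finset.sum_le_sum fun i _ => ?_
  have h2 := sub_le_of_eq_off_block hf hT (hL0 i) (hL i) (takeBlocks_mem (i : ℕ) hy hx)
    (takeBlocks_mem ((i : ℕ) + 1) hy hx) (fun j hj => by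
      have : (j : ℕ) ≠ i := fun h => hj (Fin.ext h)
      simp only [takeBlocks]
      congr 1
      simp only [eq_iff_iff]
      omega)
  have h3 : takeBlocks ((i : ℕ) + 1) y x i = y i := by simp [takeBlocks]
  have h4 : takeBlocks (i : ℕ) y x i = x i := by simp [takeBlocks]
  rwa [h3, h4] at h2

/-- One sweep of the inexact method from `x` to `y`: there is a feasible point `P` near `y` with a
small subgradient and almost the same value, and the objective decreases up to the errors. -/
theorem exists_palm_step_bound {f : BlockSpace m → ℝ} (hf : Differentiable ℝ f)
    {h : ∀ i, Fin (p i) → Blk m i → ℝ} {r : ℝ} (hr : 0 ≤ r)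
    (hne : ∀ i, (feasSet (h i)).Nonempty) (hcv : ∀ i, Convex ℝ (feasSet (h i)))
    (hcp : ∀ i, IsCompact (feasSet (h i))) {L : Fin n → ℝ} (hlip : BlockLipschitzGrad f h r L)
    {a l M : ℝ} (hl : 0 < l) (hM : 0 ≤ M) (hLa : ∀ i, L i + a ≤ l) :
    ∃ C : ℝ, 0 ≤ C ∧ ∀ x ∈ enlargedFeas h r, ∀ y ∈ enlargedFeas h r, ∀ s : Fin n → ℝ,
      (∀ i, s i ∈ Set.Icc l M) → ∀ e₀ e : ℝ, 0 ≤ e →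
      (∀ i, Metric.infDist (x i) (feasSet (h i)) ≤ e₀ ^ 2) →
      (∀ i, Metric.infDist (y i) (feasSet (h i)) ≤ e ^ 2) →
      (∀ i, ∀ w ∈ feasSet (h i),
        inner ℝ (x i - (1 / s i) • blockGrad f i (mixBlocks i y x) - y i) (w - y i) ≤ e ^ 2) →
      (∃ P ∈ prodFeas h, ∃ u : BlockSpace m,
        (∀ w ∈ prodFeas h, inner ℝ (u - gradient f P) (w - P) ≤ 0) ∧
        ‖u‖ ≤ C * (‖y - x‖ + e) ∧ ‖P - y‖ ≤ C * e ∧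
        |f P - f y| ≤ C * (‖y - x‖ ^ 2 + e ^ 2)) ∧
      f y + a * ‖y - x‖ ^ 2 ≤ f x + C * (e ^ 2 + e₀ ^ 2) := by
  set T := enlargedFeas h r with hT
  have hTc : IsCompact T := isCompact_enlargedFeas hr hne hcp
  have hTv : Convex ℝ T := convex_enlargedFeas hr hne hcv
  have hKT : prodFeas h ⊆ T := prodFeas_subset_enlargedFeas h hr
  have hL0 : ∀ i, 0 ≤ L i := fun i => (hlip i).1.le
  have hLip := fun i => (hlip i).2
  set Λ := ∑ i, L i with hΛdef
  have hΛ0 : 0 ≤ Λ := Finset.sum_nonneg fun i _ => hL0 i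
  have hΛ : ∀ a ∈ T, ∀ b ∈ T, ‖gradient f a - gradient f b‖ ≤ Λ * ‖a - b‖ :=
    fun a ha b hb => norm_gradient_sub_le hLip ha hb
  have hgc : ContinuousOn (gradient f) T :=
    (LipschitzOnWith.of_dist_le_mul (K := ⟨Λ, hΛ0⟩) fun a ha b hb => by
      rw [dist_eq_norm, dist_eq_norm]; exact hΛ a ha b hb).continuousOn
  obtain ⟨G, hG⟩ := hTc.exists_bound_of_continuousOn hgc
  obtain ⟨b, hb⟩ := hTc.isBounded.exists_norm_le
  choose w₀ hw₀ using hne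
  have hw₀K : WithLp.toLp 2 w₀ ∈ prodFeas h := hw₀
  have hb0 : 0 ≤ b := (norm_nonneg _).trans (hb _ (hKT hw₀K))
  have hG0 : 0 ≤ G := (norm_nonneg _).trans (hG _ (hKT hw₀K))
  have hbS : ∀ i, ∀ w ∈ feasSet (h i), ‖w‖ ≤ b := fun i w hw => by
    have h1 : WithLp.toLp 2 (Function.update w₀ i w) ∈ prodFeas h := fun j => by
      by_cases hj : j = i
      · subst hj; simpa using hw
      · simpa [Function.update_of_ne hj] using hw₀ j
    have h2 := (PiLp.norm_apply_le _ i).trans (hb _ (hKT h1))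
    simpa using h2
  -- Bounds `‖x̃ᵢ - w‖`: `b` for each of the two points and `G / l` for the gradient step.
  set R := b + G / l + b with hR
  have hR0 : 0 ≤ R := by positivity
  set A : ℝ := n * (1 + R) with hA
  have hA0 : 0 ≤ A := by positivity
  set C1 : ℝ := (Λ + n * M) * (1 + √A) with hC1
  set C2 : ℝ := √A with hC2
  set C3 : ℝ := (M + 2 * Λ) * (1 + 3 * A) with hC3
  set C4 : ℝ := n * (M * (1 + R)) with hC4
  have hC1' : 0 ≤ C1 := by positivity
  have hC2' : 0 ≤ C2 := by positivity
  have hC3' : 0 ≤ C3 := by positivity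
  have hC4' : 0 ≤ C4 := by positivity
  -- `C1` serves the subgradient, `C2` the distance to `P`, `C3` the gap in value and `C4` the
  -- descent.
  refine ⟨C1 + C2 + C3 + C4, by positivity, ?_⟩
  intro x hx y hy s hs e₀ e he hxS hyS hvi
  set g : ∀ i, Blk m i := fun i => blockGrad f i (mixBlocks i y x) with hg
  have hmix : ∀ i, mixBlocks i y x ∈ T := fun i => takeBlocks_mem (i : ℕ) hy hx
  have hgG : ∀ i, ‖(1 / s i) • g i‖ ≤ G / l := fun i => by
    rw [norm_smul, Real.norm_of_nonneg (one_div_nonneg.2 (hl.le.trans (hs i).1)), one_div,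
      div_eq_inv_mul]
    exact mul_le_mul (inv_anti₀ hl (hs i).1) ((PiLp.norm_apply_le _ i).trans (hG _ (hmix i)))
      (norm_nonneg _) (inv_nonneg.2 hl.le)
  have hbT : ∀ z ∈ T, ∀ i, ‖z i‖ ≤ b := fun z hz i => (PiLp.norm_apply_le z i).trans (hb z hz)
  have hdist : ∀ i, ∀ w : Blk m i, ‖w‖ ≤ b → ‖x i - (1 / s i) • g i - w‖ ≤ R := fun i w hw =>
    (norm_sub_le _ _).trans
      (add_le_add ((norm_sub_le _ _).trans (add_le_add (hbT x hx i) (hgG i))) hw)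
  have hstep := fun i => inexact_projection_step (hcp i) ⟨_, hw₀ i⟩ (hcv i) hl (hs i).1 (hs i).2
    (hxS i) (hyS i) (fun w hw => hdist i w (hbS i w hw)) (hdist i _ (hbT y hy i)) (hvi i)
  have hdsq : ‖y - x‖ ^ 2 = ∑ i, ‖y i - x i‖ ^ 2 := PiLp.norm_sq_eq_of_L2 _ _
  constructor
  · choose P hPS hPvi hPy hPg using fun i => (hstep i).2
    have hPK : WithLp.toLp 2 P ∈ prodFeas h := hPS
    set Q : BlockSpace m := WithLp.toLp 2 P with hQ
    have hQT : Q ∈ T := hKT hPK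
    have hQy : ‖Q - y‖ ^ 2 ≤ A * e ^ 2 := by
      rw [PiLp.norm_sq_eq_of_L2]
      refine (Finset.sum_le_sum fun i _ => hPy i).trans_eq ?_
      simp [hA]; ring
    have hQy' : ‖Q - y‖ ≤ √A * e := by
      refine abs_le_of_sq_le_sq' ?_ (by positivity) |>.2
      rwa [mul_pow, Real.sq_sqrt hA0]
    have hQyi : ∀ i, ‖P i - y i‖ ≤ ‖Q - y‖ := fun i => PiLp.norm_apply_le (Q - y) i
    have hyxi : ∀ i, ‖y i - x i‖ ≤ ‖y - x‖ := fun i => PiLp.norm_apply_le (y - x) i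
    have hgy : ∀ i, ‖blockGrad f i y - g i‖ ≤ L i * ‖y - x‖ := fun i =>
      (hLip i y hy _ (hmix i)).trans
        (mul_le_mul_of_nonneg_left (norm_sub_takeBlocks_le i y x) (hL0 i))
    -- Blockwise, `u - ∇f(Q)` is `s i` times the normal vector `x̃ᵢ - Pᵢ` of the projection. The
    -- gradient step inside `x̃ᵢ` nearly cancels `∇ᵢ f(Q)`, which makes `u` small.
    refine ⟨Q, hPK, WithLp.toLp 2 fun i => blockGrad f i Q + s i • (x i - (1 / s i) • g i - P i),
      ?_, ?_, ?_, ?_⟩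
    · intro w hw
      rw [PiLp.inner_apply]
      refine Finset.sum_nonpos fun i _ => ?_
      have h1 := hPvi i (w i) (hw i)
      have h2 : (WithLp.toLp 2 (fun i => blockGrad f i Q + s i • (x i - (1 / s i) • g i - P i))
          - gradient f Q : BlockSpace m) i = s i • (x i - (1 / s i) • g i - P i) := by
        simp [blockGrad]
      rw [h2, inner_smul_left]
      exact mul_nonpos_of_nonneg_of_nonpos (hl.le.trans (hs i).1) h1
    · have h1 : ∀ i, ‖blockGrad f i Q + s i • (x i - (1 / s i) • g i - P i)‖ ≤
          L i * (‖y - x‖ + ‖Q - y‖) + M * (‖y - x‖ + ‖Q - y‖) := fun i => by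
        have hsi : 0 < s i := hl.trans_le (hs i).1
        have e1 : blockGrad f i Q + s i • (x i - (1 / s i) • g i - P i) =
            (blockGrad f i Q - blockGrad f i y) + (blockGrad f i y - g i) +
              s i • (-(y i - x i) - (P i - y i)) := by
          rw [smul_sub, smul_sub, smul_smul, mul_one_div_cancel hsi.ne', one_smul]
          simp only [smul_sub, smul_neg]
          abel
        have e2 := hLip i Q hQT y hy
        have e3 : ‖s i • (-(y i - x i) - (P i - y i))‖ ≤ M * (‖y - x‖ + ‖Q - y‖) := by
          rw [norm_smul, Real.norm_of_nonneg hsi.le]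
          refine mul_le_mul (hs i).2 ((norm_sub_le _ _).trans ?_) (norm_nonneg _) hM
          rw [norm_neg]
          exact add_le_add (hyxi i) (hQyi i)
        rw [e1]
        refine (norm_add₃_le).trans ?_
        linarith [hgy i]
      have h2 : ‖(WithLp.toLp 2 fun i => blockGrad f i Q + s i • (x i - (1 / s i) • g i - P i) :
          BlockSpace m)‖ ≤ (Λ + n * M) * (‖y - x‖ + ‖Q - y‖) := by
        refine (PiLp.norm_le_sum_norm _).trans ((Finset.sum_le_sum fun i _ => h1 i).trans_eq ?_)
        rw [Finset.sum_add_distrib, ← Finset.sum_mul]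
        simp [hΛdef]; ring
      have h3 : ‖y - x‖ + ‖Q - y‖ ≤ (1 + √A) * (‖y - x‖ + e) := by
        have := mul_nonneg (Real.sqrt_nonneg A) (norm_nonneg (y - x))
        nlinarith
      refine h2.trans ((mul_le_mul_of_nonneg_left h3 (by positivity)).trans ?_)
      rw [← mul_assoc]
      exact mul_le_mul_of_nonneg_right (by linarith) (by positivity)
    · exact hQy'.trans (mul_le_mul_of_nonneg_right (by linarith) he)
    · have h1 := abs_sub_sub_inner_gradient_le hf hTv hΛ0 hΛ hy hQT
      have h2 : |inner ℝ (gradient f y) (Q - y)| ≤ M * (‖y - x‖ ^ 2 + 3 * (A * e ^ 2)) +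
          Λ * (‖y - x‖ ^ 2 + ‖Q - y‖ ^ 2) := by
        rw [PiLp.inner_apply]
        have e1 : ∀ i, |inner ℝ (gradient f y i) ((Q - y) i)| ≤
            M * (‖y i - x i‖ ^ 2 + 3 * ((1 + R) * e ^ 2)) +
              L i * (‖y - x‖ ^ 2 + ‖Q - y‖ ^ 2) := fun i => by
          -- The step used the gradient at the mixed point, not at `y`; Lipschitz continuity makes
          -- the discrepancy second order.
          have e2 : inner ℝ (gradient f y i) ((Q - y) i) =
              inner ℝ (g i) (P i - y i) + inner ℝ (blockGrad f i y - g i) (P i - y i) := by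
            rw [← inner_add_left, add_sub_cancel]; rfl
          have e3 : |inner ℝ (blockGrad f i y - g i) (P i - y i)| ≤
              L i * (‖y - x‖ * ‖Q - y‖) := by
            rw [← mul_assoc]
            exact (abs_real_inner_le_norm _ _).trans
              (mul_le_mul (hgy i) (hQyi i) (norm_nonneg _)
                (mul_nonneg (hL0 i) (norm_nonneg _)))
          have e4 : L i * (‖y - x‖ * ‖Q - y‖) ≤ L i * (‖y - x‖ ^ 2 + ‖Q - y‖ ^ 2) :=
            mul_le_mul_of_nonneg_left
              (by linarith [two_mul_le_add_sq ‖y - x‖ ‖Q - y‖,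
                mul_nonneg (norm_nonneg (y - x)) (norm_nonneg (Q - y))]) (hL0 i)
          rw [e2]
          exact (abs_add_le _ _).trans (add_le_add (hPg i) (e3.trans e4))
        refine (Finset.abs_sum_le_sum_abs _ _).trans
          ((Finset.sum_le_sum fun i _ => e1 i).trans_eq ?_)
        rw [Finset.sum_add_distrib, ← Finset.mul_sum, Finset.sum_add_distrib, ← hdsq,
          ← Finset.sum_mul Finset.univ L]
        simp only [Finset.sum_const, Finset.card_univ, Fintype.card_fin, nsmul_eq_mul, hΛdef, hA]
        ring
      have h3 : |f Q - f y| ≤ M * (‖y - x‖ ^ 2 + 3 * (A * e ^ 2)) +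
          Λ * (‖y - x‖ ^ 2 + ‖Q - y‖ ^ 2) + Λ * ‖Q - y‖ ^ 2 := by
        have := abs_sub_abs_le_abs_sub (f Q - f y) (inner ℝ (gradient f y) (Q - y))
        linarith
      have h4 : Λ * ‖Q - y‖ ^ 2 ≤ Λ * (A * e ^ 2) := mul_le_mul_of_nonneg_left hQy hΛ0
      have h5 : M * (‖y - x‖ ^ 2 + 3 * (A * e ^ 2)) +
          Λ * (‖y - x‖ ^ 2 + ‖Q - y‖ ^ 2) + Λ * ‖Q - y‖ ^ 2 ≤
          C3 * (‖y - x‖ ^ 2 + e ^ 2) := by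
        have e1 : 0 ≤ M * A * ‖y - x‖ ^ 2 := by positivity
        have e2 : 0 ≤ Λ * A * ‖y - x‖ ^ 2 := by positivity
        have e3 : 0 ≤ Λ * A * e ^ 2 := by positivity
        have e4 : 0 ≤ Λ * e ^ 2 := by positivity
        have e5 : 0 ≤ M * e ^ 2 := by positivity
        have e6 : 0 ≤ Λ * ‖y - x‖ ^ 2 := by positivity
        rw [hC3]
        linarith
      exact h3.trans (h5.trans (mul_le_mul_of_nonneg_right (by linarith) (by positivity)))
  · have h1 : f y - f x ≤ ∑ i, (inner ℝ (g i) (y i - x i) + L i * ‖y i - x i‖ ^ 2) :=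
      sub_le_sum_blocks hf hTv hL0 hLip hx hy
    have h2 : ∀ i, inner ℝ (g i) (y i - x i) + L i * ‖y i - x i‖ ^ 2 ≤
        M * (1 + R) * (e ^ 2 + e₀ ^ 2) - a * ‖y i - x i‖ ^ 2 := fun i => by
      have e1 := (hstep i).1
      have e2 : (L i + a) * ‖y i - x i‖ ^ 2 ≤ s i * ‖y i - x i‖ ^ 2 :=
        mul_le_mul_of_nonneg_right ((hLa i).trans (hs i).1) (sq_nonneg _)
      linarith
    have h3 := h1.trans (Finset.sum_le_sum fun i _ => h2 i)
    rw [Finset.sum_sub_distrib, ← Finset.mul_sum Finset.univ (fun i => ‖y i - x i‖ ^ 2),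
      ← hdsq] at h3
    simp only [Finset.sum_const, Finset.card_univ, Fintype.card_fin, nsmul_eq_mul] at h3
    have h4 : C4 * (e ^ 2 + e₀ ^ 2) ≤ (C1 + C2 + C3 + C4) * (e ^ 2 + e₀ ^ 2) :=
      mul_le_mul_of_nonneg_right (by linarith) (by positivity)
    rw [hC4] at h4
    linarith

theorem sqTail_eq_add {ε : ℕ → ℝ} (h : Summable fun k => ε k ^ 2) (k : ℕ) :
    sqTail ε k = ε k ^ 2 + sqTail ε (k + 1) := by
  have h1 : Summable fun t => ε (k + t) ^ 2 := by
    simpa only [add_comm k] using (summable_nat_add_iff k).2 h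
  rw [sqTail, h1.tsum_eq_zero_add, add_zero, sqTail]
  congr 2
  ext t
  rw [add_right_comm, add_assoc]

theorem sqTail_nonneg (ε : ℕ → ℝ) (k : ℕ) : 0 ≤ sqTail ε k :=
  tsum_nonneg fun _ => sq_nonneg _

theorem tendsto_sqTail (ε : ℕ → ℝ) : Tendsto (sqTail ε) atTop (𝓝 0) := by
  have := tendsto_sum_nat_add fun k => ε k ^ 2
  exact this.congr fun k => tsum_congr fun t => by rw [add_comm]

/-- The inexact method visits points that are feasible and satisfy the variational inequality of
the exact projection, up to a multiple of the squared tolerance. -/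
theorem IsInexactPALM.exists_bound {f : BlockSpace m → ℝ} {h : ∀ i, Fin (p i) → Blk m i → ℝ}
    (hconv : ∀ i j, ConvexOn ℝ Set.univ (h i j)) (hdiff : ∀ i j, Differentiable ℝ (h i j))
    {εbar : ℝ} (hεbar : 0 < εbar) {Ml Mu : ℝ} (hMl : 0 ≤ Ml)
    (hcon : ConstraintAssumption f h εbar Ml) {ε : ℕ → ℝ} {σ : ℕ → Fin n → ℝ}
    {z : ℕ → BlockSpace m} (hz : IsInexactPALM f h εbar Ml Mu ε σ z) :
    ∃ C : ℝ, 0 ≤ C ∧ ∀ k i, Metric.infDist (z (k + 1) i) (feasSet (h i)) ≤ C * ε k ^ 2 ∧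
      ∀ w ∈ feasSet (h i),
        inner ℝ (gradStep f σ z k i - z (k + 1) i) (w - z (k + 1) i) ≤ C * ε k ^ 2 := by
  have hH : ∀ i, HoffmanBoundOn (h i) Set.univ := fun i => by
    refine HoffmanBoundOn.univ (hconv i) (hcon.compact i) (hcon.nonempty i) hεbar ?_
    obtain ⟨c, hc, H⟩ := hcon.hoffman i
    -- The radius `gradBound / Ml` is nonnegative, so the error bound holds in particular on the
    -- `εbar`-enlargement, from which convexity extends it everywhere.
    refine ⟨c, hc, fun w hw => H w (subset_enlarge _ (div_nonneg ?_ hMl) hw)⟩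
    exact Real.sSup_nonneg (by rintro _ ⟨x, _, rfl⟩; exact norm_nonneg _)
  choose C hC0 hC using fun i =>
    exists_bound_of_kktResidual_le (hconv i) (hdiff i) (hcon.compact i) (hH i)
  refine ⟨∑ i, C i, Finset.sum_nonneg fun i _ => hC0 i, fun k i => ?_⟩
  obtain ⟨lam, hlam, hres⟩ := hz.inexact k i
  obtain ⟨h1, h2⟩ := hC i _ _ _ _ hlam (Real.sqrt_le_iff.1 hres).2
  have h3 : C i * ε k ^ 2 ≤ (∑ i, C i) * ε k ^ 2 :=
    mul_le_mul_of_nonneg_right (Finset.single_le_sum (fun i _ => hC0 i) (Finset.mem_univ i))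
      (sq_nonneg _)
  exact ⟨h1.trans h3, fun w hw => (h2 w hw).trans h3⟩

end Blocks

/-! ### The main theorem -/

/-- Convergence of the whole iterate sequence of the infeasible inexact proximal alternating
linearized minimization method under the Łojasiewicz property. -/
theorem mainTheorem1 {n : ℕ} {m p : Fin n → ℕ}
    (f : BlockSpace m → ℝ) (hf : Differentiable ℝ f)
    (h : ∀ i, Fin (p i) → Blk m i → ℝ)
    (hconv : ∀ i j, ConvexOn ℝ Set.univ (h i j))
    (hdiff : ∀ i j, Differentiable ℝ (h i j))
    (εbar : ℝ) (hεbar : 0 < εbar)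
    (L : Fin n → ℝ) (γ : ℝ) (hγ : 1 < γ) (Mu : ℝ)
    (hlip : BlockLipschitzGrad f h εbar L)
    (hcon : ConstraintAssumption f h εbar (γ * ⨆ i, L i))
    (hKL : ∀ zbar, IsStationaryPt (extObjective f h) zbar → LojasiewiczAt (extObjective f h) zbar)
    (ε : ℕ → ℝ) (hε : ToleranceCondition ε)
    (σ : ℕ → Fin n → ℝ) (z : ℕ → BlockSpace m)
    (hz : IsInexactPALM f h εbar (γ * ⨆ i, L i) Mu ε σ z) :
    ∃ zbar : BlockSpace m, IsStationaryPt (extObjective f h) zbar ∧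
      Tendsto z atTop (𝓝 zbar) := by
  -- Without blocks the supremum of `L` defaults to `0`, so no positive step bound exists; but the
  -- space is then a single point.
  rcases isEmpty_or_nonempty (Fin n) with hn | hn
  · refine ⟨z 0, mem_frechetSubdiff_extObjective hf (fun i => isEmptyElim i) fun w _ => ?_, ?_⟩
    · rw [PiLp.inner_apply, Finset.univ_eq_empty, Finset.sum_empty]
    · have : z = fun _ => z 0 := funext fun k => PiLp.ext fun i => isEmptyElim i
      rw [this]; exact tendsto_const_nhds
  have hLs : ∀ i, L i ≤ ⨆ i, L i := fun i => le_ciSup (Set.finite_range L).bddAbove i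
  have hLpos : 0 < ⨆ i, L i := (hlip hn.some).1.trans_le (hLs _)
  set l := γ * ⨆ i, L i with hl
  have hl0 : 0 < l := mul_pos (one_pos.trans hγ) hLpos
  have ha : 0 < (γ - 1) * ⨆ i, L i := mul_pos (sub_pos.2 hγ) hLpos
  have hMu : 0 ≤ Mu := hl0.le.trans hz.Ml_le_Mu
  obtain ⟨hε0, hεs, θ₀, hθ₀, hθ₀', hεθ⟩ := hε
  have hε2 : Summable fun k => ε k ^ 2 :=
    (hεs.mul_left εbar).of_nonneg_of_le (fun k => sq_nonneg _) fun k => by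
      rw [sq]; exact mul_le_mul_of_nonneg_right (hz.tol_le k) (hε0 k)
  obtain ⟨c, hc, hfeas⟩ := hz.exists_bound hconv hdiff hεbar hl0.le hcon
  obtain ⟨C, hC, hstep⟩ := exists_palm_step_bound hf hεbar.le hcon.nonempty hcon.convex
    hcon.compact hlip hl0 hMu (a := (γ - 1) * ⨆ i, L i) (fun i => by linarith [hLs i])
  -- Infeasibility is bounded by `c * ε k ^ 2`, not `ε k`, so the iterates are only known to lie in
  -- the enlargement from some index on. The further shift by one skips the arbitrary `z 0`.
  obtain ⟨N, hN⟩ : ∃ N, ∀ k ≥ N, c * ε k ^ 2 ≤ εbar := by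
    refine eventually_atTop.1 (Tendsto.eventually_le_const hεbar ?_)
    simpa using hε2.tendsto_atTop_zero.const_mul c
  have hT : ∀ k, z (N + k + 1) ∈ enlargedFeas h εbar := fun k i =>
    ((hfeas (N + k) i).1).trans (hN _ (Nat.le_add_right _ _))
  have hsq : ∀ k, (√c * ε k) ^ 2 = c * ε k ^ 2 := fun k => by rw [mul_pow, Real.sq_sqrt hc]
  -- The old point carries the tolerance of index `N + k`, the new one that of index `N + k + 1`;
  -- the factor `√c` makes their squares the actual errors.
  have hmain := fun k => hstep (z (N + k + 1)) (hT k) (z (N + (k + 1) + 1)) (hT (k + 1))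
    (σ (N + k + 1)) (hz.prox_mem _) (√c * ε (N + k)) (√c * ε (N + (k + 1)))
    (mul_nonneg (Real.sqrt_nonneg c) (hε0 _)) (fun i => by rw [hsq]; exact (hfeas _ i).1)
    (fun i => by rw [hsq]; exact (hfeas _ i).1)
    (fun i => by rw [hsq]; exact (hfeas (N + (k + 1)) i).2)
  choose P hPK u hu hunorm hPz hfP using fun k => (hmain k).1
  have hTc := isCompact_enlargedFeas hεbar.le hcon.nonempty hcon.compact
  obtain ⟨B, hB⟩ := (hTc.image hf.continuous).bddBelow
  have hgrad : ContinuousOn (gradient f) (prodFeas h) :=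
    (LipschitzOnWith.of_dist_le_mul (K := ⟨∑ i, L i, Finset.sum_nonneg fun i _ => (hlip i).1.le⟩)
      fun a ha b hb => by
        rw [dist_eq_norm, dist_eq_norm]
        exact norm_gradient_sub_le (fun i => (hlip i).2)
          (prodFeas_subset_enlargedFeas h hεbar.le ha)
          (prodFeas_subset_enlargedFeas h hεbar.le hb)).continuousOn
  have hsN : Summable fun k => sqTail ε (N + k) ^ θ₀ := by
    simpa only [add_comm N] using (summable_nat_add_iff N).2 hεθ
  have htN : Tendsto (fun k => sqTail ε (N + k)) atTop (𝓝 0) := by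
    simpa only [add_comm N, Function.comp_def] using (tendsto_sqTail ε).comp (tendsto_add_atTop_nat N)
  obtain ⟨x, hx, hzx⟩ := exists_tendsto_of_inexact_descent
    (isCompact_prodFeas hcon.compact) hf hgrad (fun x hx => extObjective_of_mem hx)
    (fun x hx u hu => mem_frechetSubdiff_extObjective hf hx hu) hKL
    (z := fun k => z (N + k + 1)) (P := P) (u := u) (η := fun k => √c * ε (N + (k + 1)))
    -- Two consecutive tails, so that `β k - β (k + 1)` is exactly `C * c` times the sum of the two
    -- squared tolerances in the descent estimate.
    (β := fun k => C * c * (sqTail ε (N + k) + sqTail ε (N + (k + 1)))) (C := C)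
    (a := (γ - 1) * ⨆ i, L i) (B := B) (θ₀ := θ₀) hC ha hθ₀ hθ₀'
    (fun k => mul_nonneg (Real.sqrt_nonneg c) (hε0 _))
    (Summable.mul_left _ (by
      simpa only [add_comm, add_assoc, add_left_comm] using (summable_nat_add_iff (N + 1)).2 hεs))
    (fun k => mul_nonneg (mul_nonneg hC hc) (add_nonneg (sqTail_nonneg _ _) (sqTail_nonneg _ _)))
    (by simpa using (htN.add (htN.comp (tendsto_add_atTop_nat 1))).const_mul (C * c))
    (by
      refine ((hsN.add ((summable_nat_add_iff 1).2 hsN)).mul_left ((C * c) ^ θ₀)).of_nonneg_of_le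
        (fun k => Real.rpow_nonneg (mul_nonneg (mul_nonneg hC hc)
          (add_nonneg (sqTail_nonneg _ _) (sqTail_nonneg _ _))) _) fun k => ?_
      rw [Real.mul_rpow (mul_nonneg hC hc) (add_nonneg (sqTail_nonneg _ _) (sqTail_nonneg _ _))]
      exact mul_le_mul_of_nonneg_left (Real.rpow_add_le_add_rpow (sqTail_nonneg _ _)
        (sqTail_nonneg _ _) hθ₀.le hθ₀'.le) (Real.rpow_nonneg (mul_nonneg hC hc) _))
    hPK hu (fun k => hB ⟨_, hT k, rfl⟩) hunorm hPz hfP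
    (fun k => by
      have h1 := (hmain k).2
      rw [hsq, hsq] at h1
      have h2 := sqTail_eq_add hε2 (N + k)
      have h3 := sqTail_eq_add hε2 (N + (k + 1))
      simp only [← add_assoc] at h1 h2 h3 ⊢
      rw [h2, h3]
      linarith)
  refine ⟨x, hx, (tendsto_add_atTop_iff_nat (N + 1)).1 ?_⟩
  refine hzx.congr fun k => ?_
  rw [add_comm N k, add_assoc]
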